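/- Let $n\ge 0$ and let $P$ be a poset on $\{1,2,\ldots,n\}$ with order $\le_P$ which is naturally labeled, i.e. $i<j$ whenever $i<_P j$. A linear extension of $P$ is a permutation $w=w_1w_2\cdots w_n$ of $\{1,\ldots,n\}$ such that $i<j$ whenever $w_i<_P w_j$; $\mathcal L(P)$ is the set of these, and $\mathrm{maj}(w)=\sum_{1\le i\le n-1,\ w_i>w_{i+1}} i$. A connected order ideal of $P$ is a nonempty down-closed subset $J$ of $P$ whose Hasse diagram is a connected graph. Let $G_P$ be the graph whose vertices are the connected order ideals of $P$, two of them being adjacent if they have nonempty intersection and neither contains the other. Let $C_1,\ldots,C_h$ be the connected components of $G_P$, with vertex sets $V(C_r)$. For a graph $G$, let $\mathscr M(G)$ be the set of its maximum independent sets, i.e. its independent sets of largest possible size. For $M\in\mathscr M(G_P)$ and $J\in M$ put $\mu(M,J)=\bigcup_{J'\in M,\ J'\subsetneq J}J'$. Let $F_M$ be the partial order on $\{1,\ldots,n\}$ in which $i<_{F_M}j$ if and only if there are $J_a,J_b\in M$ with $J_a\setminus\mu(M,J_a)=\{i\}$, $J_b\setminus\mu(M,J_b)=\{j\}$ and $J_a\subsetneq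 J_b$, and let $$\mathrm{Des}(M)=\{\,i \mid i \text{ is covered in } F_M \text{ by some } j \text{ with } i>j\,\}.$$ For $M_r\in\mathscr M(C_r)$ and $M\in\mathscr M(G_P)$ with $M\cap V(C_r)=M_r$ let $$\mathrm{Des}(M_r,M)=\{\,i\in\mathrm{Des}(M)\mid \{i\}=J\setminus\mu(M,J)\text{ for some }J\in M_r\,\},$$ $$\overline{\mathrm{Des}}(M_r,M)=\{\,J\in M_r\mid J\setminus\mu(M,J)=\{i\}\text{ for some } i\in\mathrm{Des}(M_r,M)\,\}.$$ Then for every $r$ and every $M_r\in\mathscr M(C_r)$ there is an $M\in\mathscr M(G_P)$ with $M\cap V(C_r)=M_r$, and $\overline{\mathrm{Des}}(M_r,M)$ does not depend on the choice of such an $M$, so that it may be denoted by $\overline{\mathrm{Des}}(M_r)$. Moreover, with $[i]_q=1-q^i$ and $[m]!_q=\prod_{i=1}^m[i]_q$, the following identity of rational functions in the indeterminate $q$ (over $\mathbb Q$) holds: $$\sum_{w\in\mathcal L(P)}q^{\mathrm{maj}(w)}=[n]!_q\prod_{r=1}^h\ \sum_{M_r\in\mathscr M(C_r)}\frac{q^{\sum_{J\in\overline{\mathrm{Des}}(M_r)}|J|}}{\prod_{J\in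 M_r}[|J|]_q}.$$ -/

import Mathlib

/-!  A poset `P` on `{1, …, n}` is a term `P : PartialOrder (Fin n)`, the element `i : Fin n`
standing for `i + 1`. The order of `P` is always written `P.le`, `P.lt`; the natural order of the
labels is always the order of natural numbers `(i : ℕ) < (j : ℕ)`. -/

namespace ConnectedOrderIdeals

open Finset

/-- `P` is naturally labeled: `i <_P j` implies `i < j`. -/
def NaturallyLabeled {n : ℕ} (P : PartialOrder (Fin n)) : Prop :=
  ∀ i j : Fin n, P.lt i j → (i : ℕ) < (j : ℕ)

/-- The permutation `w = w_1 ⋯ w_n` is a linear extension of `P`: whenever `w_i <_P w_j`, `i < j`. -/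
def IsLinearExtension {n : ℕ} (P : PartialOrder (Fin n)) (w : Equiv.Perm (Fin n)) : Prop :=
  ∀ i j : Fin n, P.lt (w i) (w j) → (i : ℕ) < (j : ℕ)

open Classical in
/-- The set `L(P)` of linear extensions of `P`. -/
noncomputable def linearExtensions {n : ℕ} (P : PartialOrder (Fin n)) :
    Finset (Equiv.Perm (Fin n)) :=
  univ.filter (IsLinearExtension P)

/-- The descent set of a permutation: the positions `k` with `1 ≤ k ≤ n - 1` and `w_k > w_{k+1}`
(positions counted from 1, so that `w_k` is the value of `w` at `k - 1 : Fin n`). -/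
def permDes {n : ℕ} (w : Equiv.Perm (Fin n)) : Finset ℕ :=
  (Finset.Icc 1 (n - 1)).filter fun k =>
    ∃ i j : Fin n, (i : ℕ) + 1 = k ∧ (j : ℕ) = k ∧ (w j : ℕ) < (w i : ℕ)

/-- The major index of a permutation. -/
def maj {n : ℕ} (w : Equiv.Perm (Fin n)) : ℕ := ∑ k ∈ permDes w, k

/-- `J` is a connected order ideal of `P`: a down-closed set whose Hasse diagram is a connected
(in particular nonempty) graph. As `J` is down-closed, the Hasse diagram of `J` is the Hasse
diagram of `P` restricted to `J`. -/
def IsConnIdeal {n : ℕ} (P : PartialOrder (Fin n)) (J : Finset (Fin n)) : Prop :=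
  (∀ i ∈ J, ∀ j, P.le j i → j ∈ J) ∧
    ((@SimpleGraph.hasse (Fin n) P.toPreorder).induce (J : Set (Fin n))).Connected

/-- The set of connected order ideals of `P`. -/
abbrev ConnIdeal {n : ℕ} (P : PartialOrder (Fin n)) : Type :=
  {J : Finset (Fin n) // IsConnIdeal P J}

/-- The graph `G_P`: its vertices are the connected order ideals of `P`, and two of them are
adjacent if they intersect and neither contains the other. -/
def idealGraph {n : ℕ} (P : PartialOrder (Fin n)) : SimpleGraph (ConnIdeal P) where
  Adj J K := (J.1 ∩ K.1).Nonempty ∧ ¬ J.1 ⊆ K.1 ∧ ¬ K.1 ⊆ J.1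
  symm := ⟨fun J K h => ⟨by rw [Finset.inter_comm]; exact h.1, h.2.2, h.2.1⟩⟩
  loopless := ⟨fun _ h => h.2.1 (Finset.Subset.refl _)⟩

open Classical in
noncomputable instance {n : ℕ} (P : PartialOrder (Fin n)) :
    Fintype (idealGraph P).ConnectedComponent := Fintype.ofFinite _

/-- The set `𝓜(G_P)` of maximum independent sets of `G_P`. -/
abbrev MaxIndep {n : ℕ} (P : PartialOrder (Fin n)) : Type :=
  {M : Finset (ConnIdeal P) // (idealGraph P).IsMaximumIndepSet M}

open Classical in
/-- The set `𝓜(C)` of maximum independent sets of the connected component `C` of `G_P`, each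
regarded as a set of vertices of `G_P`. -/
noncomputable def compMaxIndep {n : ℕ} {P : PartialOrder (Fin n)}
    (C : (idealGraph P).ConnectedComponent) : Finset (Finset (ConnIdeal P)) :=
  (univ.filter fun S : Finset C => C.toSimpleGraph.IsMaximumIndepSet S).image
    fun S => S.map (Function.Embedding.subtype _)

open Classical in
/-- `μ(M, J)`, the union of all `J' ∈ M` with `J' ⊊ J`. -/
noncomputable def mu {n : ℕ} {P : PartialOrder (Fin n)}
    (M : Finset (ConnIdeal P)) (J : ConnIdeal P) : Finset (Fin n) :=
  (M.filter fun J' => J'.1 ⊂ J.1).biUnion fun J' => J'.1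

/-- The relation `i <_{F_M} j`: there are `J_a, J_b ∈ M` with `J_a \ μ(M, J_a) = {i}`,
`J_b \ μ(M, J_b) = {j}` and `J_a ⊊ J_b`. -/
def forestLT {n : ℕ} {P : PartialOrder (Fin n)} (M : Finset (ConnIdeal P)) (i j : Fin n) : Prop :=
  ∃ Ja ∈ M, ∃ Jb ∈ M, Ja.1 \ mu M Ja = {i} ∧ Jb.1 \ mu M Jb = {j} ∧ Ja.1 ⊂ Jb.1

theorem mem_and_notMem_of_sdiff {n : ℕ} {A B : Finset (Fin n)} {i : Fin n} (h : A \ B = {i}) :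
    i ∈ A ∧ i ∉ B := by
  have : i ∈ A \ B := by rw [h]; exact Finset.mem_singleton_self i
  exact Finset.mem_sdiff.1 this

theorem subset_mu {n : ℕ} {P : PartialOrder (Fin n)} {M : Finset (ConnIdeal P)}
    {J K : ConnIdeal P} (hJ : J ∈ M) (h : J.1 ⊂ K.1) : J.1 ⊆ mu M K := by
  classical
  intro x hx
  unfold mu
  exact Finset.mem_biUnion.2 ⟨J, Finset.mem_filter.2 ⟨hJ, h⟩, hx⟩

theorem forestLT_irrefl {n : ℕ} {P : PartialOrder (Fin n)} (M : Finset (ConnIdeal P))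
    (i : Fin n) : ¬ forestLT M i i := by
  rintro ⟨Ja, ha, Jb, -, h1, h2, h3⟩
  exact (mem_and_notMem_of_sdiff h2).2 (subset_mu ha h3 (mem_and_notMem_of_sdiff h1).1)

theorem forestLT_trans {n : ℕ} {P : PartialOrder (Fin n)} {M : Finset (ConnIdeal P)}
    (hM : (idealGraph P).IsIndepSet (M : Set (ConnIdeal P))) {i j k : Fin n}
    (hij : forestLT M i j) (hjk : forestLT M j k) : forestLT M i k := by
  obtain ⟨Ja, ha, Jb, hb, h1, h2, h3⟩ := hij
  obtain ⟨Jc, hc, Jd, hd, h4, h5, h6⟩ := hjk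
  have mb := mem_and_notMem_of_sdiff h2
  have mc := mem_and_notMem_of_sdiff h4
  have hbc : Jb = Jc := by
    by_contra hne
    have hna := hM (Finset.mem_coe.2 hb) (Finset.mem_coe.2 hc) hne
    have hne' : Jb.1 ≠ Jc.1 := fun h => hne (Subtype.ext h)
    by_cases h7 : Jb.1 ⊆ Jc.1
    · exact mc.2 (subset_mu hb (Finset.ssubset_iff_subset_ne.2 ⟨h7, hne'⟩) mb.1)
    · by_cases h8 : Jc.1 ⊆ Jb.1
      · exact mb.2 (subset_mu hc (Finset.ssubset_iff_subset_ne.2 ⟨h8, hne'.symm⟩) mc.1)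
      · exact hna ⟨⟨j, Finset.mem_inter.2 ⟨mb.1, mc.1⟩⟩, h7, h8⟩
  subst hbc
  exact ⟨Ja, ha, Jd, hd, h1, h5, h3.trans h6⟩

/-- The poset `F_M = Ψ(M)` on `{1, …, n}` of a maximum independent set `M` of `G_P`. -/
def forest {n : ℕ} {P : PartialOrder (Fin n)} (M : MaxIndep P) : PartialOrder (Fin n) where
  le i j := i = j ∨ forestLT M.1 i j
  lt i j := forestLT M.1 i j
  le_refl i := Or.inl rfl
  le_trans i j k hij hjk := by
    rcases hij with rfl | hij
    · exact hjk
    · rcases hjk with rfl | hjk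
      · exact Or.inr hij
      · exact Or.inr (forestLT_trans M.2.isIndepSet hij hjk)
  lt_iff_le_not_ge i j := by
    constructor
    · intro h
      refine ⟨Or.inr h, ?_⟩
      rintro (rfl | h')
      · exact forestLT_irrefl _ _ h
      · exact forestLT_irrefl _ _ (forestLT_trans M.2.isIndepSet h h')
    · rintro ⟨rfl | h, h'⟩
      · exact absurd (Or.inl rfl) h'
      · exact h
  le_antisymm i j hij hji := by
    rcases hij with rfl | hij
    · rfl
    · rcases hji with rfl | hji
      · rfl
      · exact absurd (forestLT_trans M.2.isIndepSet hij hji) (forestLT_irrefl _ _)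

/-- The descent set of a forest `F` on `{1, …, n}`: those `i` that have a parent `j` (an element
covering `i` in `F`) with `i > j`. Roots are not descents. -/
def forestDes {n : ℕ} (F : PartialOrder (Fin n)) : Set (Fin n) :=
  {i | ∃ j, @CovBy (Fin n) F.toPreorder.toLT i j ∧ (j : ℕ) < (i : ℕ)}

/-- `Des(M) = Des(F_M)`. -/
def des {n : ℕ} {P : PartialOrder (Fin n)} (M : MaxIndep P) : Set (Fin n) := forestDes (forest M)

/-- `Des(M_r, M)`. -/
def desIn {n : ℕ} {P : PartialOrder (Fin n)} (Mr : Finset (ConnIdeal P)) (M : MaxIndep P) :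
    Set (Fin n) :=
  {i | i ∈ des M ∧ ∃ J ∈ Mr, J.1 \ mu M.1 J = {i}}

open Classical in
/-- `\overline{Des}(M_r, M)`. -/
noncomputable def desBarIn {n : ℕ} {P : PartialOrder (Fin n)} (Mr : Finset (ConnIdeal P))
    (M : MaxIndep P) : Finset (ConnIdeal P) :=
  Mr.filter fun J => ∃ i ∈ desIn Mr M, J.1 \ mu M.1 J = {i}

open Classical in
/-- `\overline{Des}(M_r)` for `M_r ∈ 𝓜(C)`: the set `\overline{Des}(M_r, M)` for some
`M ∈ 𝓜(G_P)` with `M ∩ V(C) = M_r` (and `∅` if there is no such `M`). -/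
noncomputable def desBar {n : ℕ} {P : PartialOrder (Fin n)}
    (C : (idealGraph P).ConnectedComponent) (Mr : Finset (ConnIdeal P)) :
    Finset (ConnIdeal P) :=
  if h : ∃ M : MaxIndep P, (M.1 : Set (ConnIdeal P)) ∩ C.supp = (Mr : Set (ConnIdeal P)) then
    desBarIn Mr h.choose
  else ∅

/-- The indeterminate `q`, in the field of rational functions over `ℚ`. -/
noncomputable def q : RatFunc ℚ := RatFunc.X

/-- `[i]_q = 1 - q^i`. -/
noncomputable def qBracket (i : ℕ) : RatFunc ℚ := 1 - q ^ i

/-- `[m]!_q = [1]_q [2]_q ⋯ [m]_q`. -/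
noncomputable def qFactorial (m : ℕ) : RatFunc ℚ := ∏ i ∈ Finset.Icc 1 m, qBracket i

end ConnectedOrderIdeals

namespace ConnectedOrderIdeals

open Finset

variable {n : ℕ} {P : PartialOrder (Fin n)}

/-! Call a family of connected ideals laminar if its members are pairwise disjoint or nested; these
are the independent sets of `idealGraph P`. Give `J` the weight q^|J| / (1 - q^|J|), and let
`laminarSum P U` be the sum over the laminar families inside `U` of the products of weights. In the
background are P-partitions: for an ideal `U` this sum enumerates the order-reversing maps from `U`
to ℕ by the sum of their values, such a map being the sum of the indicators of the components of its
superlevel sets. The theorem comes from evaluating `laminarSum P univ` in two ways.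

Grouping families by their union gives L(U) = ∑ q^|A| L(A), over the ideals A ⊆ U (`laminarSum_eq`).
Sorting the A by the largest label of U \ A matches this recursion with the removal of the last
letter of a linear extension, so that the sum of q^maj is [n]!_q L(univ) (`sum_linearExtensions`).

On the other side, a laminar family is of maximum size exactly when it has n members, and then each
member adds a single new element, its label. Every laminar `N` has a canonical completion `canon hP
N` to such a full family, and the families completed to a given `M` form the Boolean interval from
`descents M` to `M`. Summing over this interval leaves q^|J| / (1 - q^|J|) for the descents and 1 /
(1 - q^|J|) for the other members (`laminarSum_univ`).

Finally, ideals in different components of the graph are compatible, so full families are arbitrary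
unions of maximum families of the components (`part` and `glue`). The union of a component is a
connected ideal compatible with every other, hence it lies in every full family. It shields the
component from the rest, so being a descent depends only on the part of `M` in that component
(`isDescent_of_agree`). This gives independence of `M` and the product formula. -/

theorem reflTransGen_covBy_of_le {α : Type*} [PartialOrder α] [Finite α] {a b : α} (h : a ≤ b) :
    Relation.ReflTransGen (· ⋖ ·) a b := by
  classical
  have := Fintype.ofFinite α
  let _ : LocallyFiniteOrder α := Fintype.toLocallyFiniteOrder
  exact le_iff_reflTransGen_covBy.1 h

theorem le_of_reflTransGen_covBy {α : Type*} [PartialOrder α] {a b : α}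
    (h : Relation.ReflTransGen (· ⋖ ·) a b) : a ≤ b := by
  induction h with
  | refl => exact le_rfl
  | tail _ h ih => exact ih.trans h.le

/-! ### Order ideals and connectedness -/

/-- `S` is an order ideal (a down-closed set) of `P`. -/
def IsDown (P : PartialOrder (Fin n)) (S : Finset (Fin n)) : Prop :=
  ∀ i ∈ S, ∀ j, P.le j i → j ∈ S

theorem IsDown.union {A B : Finset (Fin n)} (hA : IsDown P A) (hB : IsDown P B) :
    IsDown P (A ∪ B) := by
  intro i hi j hj
  rcases Finset.mem_union.1 hi with h | h
  · exact Finset.mem_union_left _ (hA i h j hj)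
  · exact Finset.mem_union_right _ (hB i h j hj)

theorem isDown_univ : IsDown P univ := fun _ _ _ _ => mem_univ _

theorem isDown_empty : IsDown P ∅ := fun _ h => absurd h (notMem_empty _)

theorem IsConnIdeal.isDown {J : Finset (Fin n)} (h : IsConnIdeal P J) : IsDown P J := h.1

theorem IsConnIdeal.nonempty {J : Finset (Fin n)} (h : IsConnIdeal P J) : J.Nonempty := by
  obtain ⟨x, hx⟩ := h.2.nonempty
  exact ⟨x, hx⟩

/-- A connected ideal inside a disjoint union of two ideals lies in the one that it meets. -/
theorem IsConnIdeal.subset_of_mem {J A B : Finset (Fin n)} (h : IsConnIdeal P J)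
    (hA : IsDown P A) (hB : IsDown P B) (hd : Disjoint A B) (hs : J ⊆ A ∪ B)
    {x : Fin n} (hxJ : x ∈ J) (hxA : x ∈ A) : J ⊆ A := by
  intro y hy
  have hr := h.2.preconnected ⟨x, hxJ⟩ ⟨y, hy⟩
  rw [SimpleGraph.reachable_iff_reflTransGen] at hr
  have key : ∀ z : (J : Set (Fin n)), Relation.ReflTransGen
      ((@SimpleGraph.hasse (Fin n) P.toPreorder).induce (J : Set (Fin n))).Adj ⟨x, hxJ⟩ z →
      z.1 ∈ A := by
    intro z hz
    induction hz with
    | refl => exact hxA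
    | @tail b c _ hbc ih =>
      have hadj := (@SimpleGraph.hasse_adj (Fin n) P.toPreorder b.1 c.1).1
        (SimpleGraph.comap_adj.1 hbc)
      rcases hadj with h1 | h1
      · rcases Finset.mem_union.1 (hs c.2) with h2 | h2
        · exact h2
        · exact absurd (hB _ h2 _ (@CovBy.le _ P.toPreorder _ _ h1))
            (Finset.disjoint_left.1 hd ih)
      · exact hA _ ih _ (@CovBy.le _ P.toPreorder _ _ h1)
  exact key _ hr

/-- The elements of `J` reachable from a given one and the remaining ones both form ideals, because
relations of `P` within `J` are paths of covers. Connectedness can thus be tested on splittings into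
disjoint ideals, which is also how `IsConnIdeal.subset_of_mem` uses it. -/
theorem isConnIdeal_of_forall {J : Finset (Fin n)} (hJ : IsDown P J) (hne : J.Nonempty)
    (h : ∀ A B : Finset (Fin n), IsDown P A → IsDown P B → Disjoint A B → A ∪ B = J →
      A.Nonempty → J ⊆ A) : IsConnIdeal P J := by
  classical
  refine ⟨hJ, ?_⟩
  obtain ⟨x, hx⟩ := hne
  set G := (@SimpleGraph.hasse (Fin n) P.toPreorder).induce (J : Set (Fin n)) with hG
  have hle : ∀ a b (hb : b ∈ J), P.le a b → ∀ ha : a ∈ J, G.Reachable ⟨b, hb⟩ ⟨a, ha⟩ := by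
    intro a b hb hab
    have hc := @reflTransGen_covBy_of_le (Fin n) P _ a b hab
    induction hc with
    | refl => intro ha; exact SimpleGraph.Reachable.refl _
    | @tail c d hac hcd ih =>
      intro ha
      have hcJ : c ∈ J := hJ _ hb _ (@CovBy.le _ P.toPreorder _ _ hcd)
      have hac' : P.le a c :=
        @le_of_reflTransGen_covBy (Fin n) P a c hac
      refine SimpleGraph.Reachable.trans (SimpleGraph.Adj.reachable ?_) (ih hcJ hac' ha)
      exact SimpleGraph.comap_adj.2
        ((@SimpleGraph.hasse_adj (Fin n) P.toPreorder d c).2 (Or.inr hcd))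
  set A := J.filter fun a => ∃ ha : a ∈ J, G.Reachable ⟨x, hx⟩ ⟨a, ha⟩ with hAdef
  have hA : IsDown P A := by
    intro i hi j hj
    obtain ⟨h1, h2, h3⟩ := Finset.mem_filter.1 hi
    have := hJ _ h1 _ hj
    exact Finset.mem_filter.2 ⟨this, this, h3.trans (hle j i h2 hj this)⟩
  have hB : IsDown P (J \ A) := by
    intro i hi j hj
    obtain ⟨h1, h2⟩ := Finset.mem_sdiff.1 hi
    have hj' := hJ _ h1 _ hj
    refine Finset.mem_sdiff.2 ⟨hj', fun h4 => h2 ?_⟩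
    obtain ⟨_, h5, h6⟩ := Finset.mem_filter.1 h4
    exact Finset.mem_filter.2 ⟨h1, h1, h6.trans (hle j i h1 hj h5).symm⟩
  have hxA : x ∈ A := Finset.mem_filter.2 ⟨hx, hx, SimpleGraph.Reachable.refl _⟩
  have hJA := h A (J \ A) hA hB Finset.disjoint_sdiff
    (Finset.union_sdiff_of_subset (Finset.filter_subset _ _)) ⟨x, hxA⟩
  have hall : ∀ y : (J : Set (Fin n)), G.Reachable ⟨x, hx⟩ y := by
    rintro ⟨y, hy⟩
    obtain ⟨_, _, h6⟩ := Finset.mem_filter.1 (hJA hy)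
    exact h6
  exact { preconnected := fun a b => (hall a).symm.trans (hall b), nonempty := ⟨⟨x, hx⟩⟩ }

/-- Two connected ideals are disjoint or nested. -/
def Compatible (J K : Finset (Fin n)) : Prop :=
  Disjoint J K ∨ J ⊆ K ∨ K ⊆ J

theorem not_adj_iff {J K : ConnIdeal P} : ¬ (idealGraph P).Adj J K ↔ Compatible J.1 K.1 := by
  change ¬ ((J.1 ∩ K.1).Nonempty ∧ ¬ J.1 ⊆ K.1 ∧ ¬ K.1 ⊆ J.1) ↔ _
  unfold Compatible
  rw [Finset.disjoint_iff_inter_eq_empty, Finset.nonempty_iff_ne_empty]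
  tauto

theorem Compatible.nested {J K : Finset (Fin n)} (h : Compatible J K) {x : Fin n} (hJ : x ∈ J)
    (hK : x ∈ K) : J ⊆ K ∨ K ⊆ J :=
  h.resolve_left fun hd => Finset.disjoint_left.1 hd hJ hK

theorem Compatible.symm {J K : Finset (Fin n)} (h : Compatible J K) : Compatible K J := by
  rcases h with h | h | h
  · exact Or.inl h.symm
  · exact Or.inr (Or.inr h)
  · exact Or.inr (Or.inl h)

/-- The principal ideal of an element is connected. -/
theorem isConnIdeal_principal (j : Fin n) :
    ∃ J : Finset (Fin n), IsConnIdeal P J ∧ ∀ x, x ∈ J ↔ P.le x j := by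
  classical
  refine ⟨univ.filter fun x => P.le x j, ?_, by simp⟩
  refine isConnIdeal_of_forall ?_ ⟨j, by simp⟩ ?_
  · intro i hi k hk
    exact mem_filter.2 ⟨mem_univ _, P.le_trans _ _ _ hk (mem_filter.1 hi).2⟩
  · intro A B hA hB hd hAB ⟨y, hy⟩ x hx
    have hj : j ∈ A ∪ B := by rw [hAB]; simp
    have hyj : P.le y j := by
      have : y ∈ A ∪ B := mem_union_left _ hy
      rw [hAB] at this
      exact (mem_filter.1 this).2
    rcases mem_union.1 hj with hj | hj
    · exact hA _ hj _ (mem_filter.1 hx).2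
    · exact absurd (hB _ hj _ hyj) (disjoint_left.1 hd hy)

/-- The connected component of an element of an order ideal. -/
theorem exists_component {I : Finset (Fin n)} (hI : IsDown P I) {i : Fin n} (hi : i ∈ I) :
    ∃ J : ConnIdeal P, i ∈ J.1 ∧ J.1 ⊆ I ∧ IsDown P (I \ J.1) := by
  classical
  -- The component is a smallest `A` through `i` such that `A` and its complement in `I` are both
  -- ideals.
  let F := I.powerset.filter fun A => i ∈ A ∧ IsDown P A ∧ IsDown P (I \ A)
  have hF : F.Nonempty := ⟨I, by simp [F, hi, hI, isDown_empty]⟩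
  obtain ⟨A, hAF, hmin⟩ := F.exists_min_image Finset.card hF
  obtain ⟨hAI, hiA, hA, hIA⟩ := mem_filter.1 hAF
  rw [mem_powerset] at hAI
  have key : ∀ A' B' : Finset (Fin n), IsDown P A' → IsDown P B' → Disjoint A' B' →
      A' ∪ B' = A → i ∈ A' → A ⊆ A' := by
    intro A' B' hA' hB' hd hU hi'
    have hsub : A' ⊆ A := hU ▸ subset_union_left
    have hmem : A' ∈ F := by
      refine mem_filter.2 ⟨mem_powerset.2 (hsub.trans hAI), hi', hA', ?_⟩
      have : I \ A' = (I \ A) ∪ B' := by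
        ext x
        have h1 := @hAI x
        have h2 : x ∈ A ↔ x ∈ A' ∨ x ∈ B' := by rw [← hU, mem_union]
        have h3 : x ∈ A' → x ∉ B' := fun h => disjoint_left.1 hd h
        simp only [mem_sdiff, mem_union]
        tauto
      rw [this]
      exact hIA.union hB'
    exact (eq_of_subset_of_card_le hsub (hmin A' hmem)).ge
  refine ⟨⟨A, isConnIdeal_of_forall hA ⟨i, hiA⟩ ?_⟩, hiA, hAI, hIA⟩
  intro A' B' hA' hB' hd hU ⟨y, hy⟩
  have hi' : i ∈ A' ∪ B' := hU ▸ hiA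
  rcases mem_union.1 hi' with h | h
  · exact key A' B' hA' hB' hd hU h
  · have hyA : y ∈ A := hU ▸ mem_union_left _ hy
    exact absurd (key B' A' hB' hA' hd.symm (by rwa [union_comm]) h hyA) (disjoint_left.1 hd hy)

/-- A connected ideal meeting a component of an ideal that contains it lies in that component. -/
theorem subset_component {I J K : Finset (Fin n)} (hJ : IsDown P J) (hIJ : IsDown P (I \ J))
    (hK : IsConnIdeal P K) (hKI : K ⊆ I) {x : Fin n} (hxK : x ∈ K) (hxJ : x ∈ J) : K ⊆ J := by
  refine hK.subset_of_mem hJ hIJ disjoint_sdiff ?_ hxK hxJ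
  intro y hy
  by_cases h : y ∈ J
  · exact mem_union_left _ h
  · exact mem_union_right _ (mem_sdiff.2 ⟨hKI hy, h⟩)

/-! ### Weighted sums over families with free members -/

/-- Inserting `t` maps the members of `F` avoiding `t` bijectively onto those containing it, and
multiplies the product by `y t`. -/
theorem sum_mem_of_insert_mem_iff {α K : Type*} [DecidableEq α] [Field K] (F : Finset (Finset α))
    (y : α → K) (t : α) (hF : ∀ N, insert t N ∈ F ↔ N ∈ F) :
    (1 + y t) * ∑ N ∈ F.filter (fun N => t ∈ N), ∏ J ∈ N, y J = y t * ∑ N ∈ F, ∏ J ∈ N, y J := by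
  have h1 : ∑ N ∈ F.filter (fun N => t ∈ N), ∏ J ∈ N, y J =
      y t * ∑ N ∈ F.filter (fun N => t ∉ N), ∏ J ∈ N, y J := by
    rw [Finset.mul_sum]
    refine Finset.sum_bij' (fun N _ => N.erase t) (fun N _ => insert t N) ?_ ?_ ?_ ?_ ?_
    · intro N hN
      obtain ⟨h1, h2⟩ := mem_filter.1 hN
      refine mem_filter.2 ⟨(hF _).1 ?_, notMem_erase _ _⟩
      rwa [insert_erase h2]
    · intro N hN
      obtain ⟨h1, h2⟩ := mem_filter.1 hN
      exact mem_filter.2 ⟨(hF _).2 h1, mem_insert_self _ _⟩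
    · intro N hN
      exact insert_erase (mem_filter.1 hN).2
    · intro N hN
      exact erase_insert (mem_filter.1 hN).2
    · intro N hN
      exact (mul_prod_erase N y (mem_filter.1 hN).2).symm
  rw [← sum_filter_add_sum_filter_not F (fun N => t ∈ N), h1]
  ring

theorem sum_superset_of_insert_mem_iff {α K : Type*} [DecidableEq α] [Field K]
    (F : Finset (Finset α)) (y : α → K) (T : Finset α)
    (hF : ∀ t ∈ T, ∀ N, insert t N ∈ F ↔ N ∈ F) :
    (∏ t ∈ T, (1 + y t)) * ∑ N ∈ F.filter (fun N => T ⊆ N), ∏ J ∈ N, y J =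
      (∏ t ∈ T, y t) * ∑ N ∈ F, ∏ J ∈ N, y J := by
  induction T using Finset.induction_on with
  | empty => simp
  | insert t T ht ih =>
    have h1 : F.filter (fun N => insert t T ⊆ N) =
        (F.filter (fun N => T ⊆ N)).filter (fun N => t ∈ N) := by
      ext N
      simp only [mem_filter, insert_subset_iff]
      tauto
    have h2 := sum_mem_of_insert_mem_iff (F.filter (fun N => T ⊆ N)) y t (by
      intro N
      simp only [mem_filter, hF t (mem_insert_self _ _), subset_insert_iff_of_notMem ht])
    have h3 := ih fun s hs => hF s (mem_insert_of_mem hs)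
    rw [h1, prod_insert ht, prod_insert ht]
    calc _ = (∏ s ∈ T, (1 + y s)) * ((1 + y t) *
          ∑ N ∈ (F.filter (fun N => T ⊆ N)).filter (fun N => t ∈ N), ∏ J ∈ N, y J) := by ring
      _ = y t * ((∏ s ∈ T, (1 + y s)) * ∑ N ∈ F.filter (fun N => T ⊆ N), ∏ J ∈ N, y J) := by
          rw [h2]; ring
      _ = _ := by rw [h3]; ring

theorem qBracket_ne_zero {k : ℕ} (hk : k ≠ 0) : qBracket k ≠ 0 := by
  intro h
  have h1 : (RatFunc.X : RatFunc ℚ) ^ k = 1 := (sub_eq_zero.1 h).symm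
  have h2 : algebraMap (Polynomial ℚ) (RatFunc ℚ) (Polynomial.X ^ k) =
      algebraMap (Polynomial ℚ) (RatFunc ℚ) 1 := by
    rw [map_pow, RatFunc.algebraMap_X, h1, map_one]
  have h3 := congrArg Polynomial.natDegree (RatFunc.algebraMap_injective ℚ h2)
  rw [Polynomial.natDegree_X_pow, Polynomial.natDegree_one] at h3
  exact hk h3

/-- `q^m / (1 - q^m)` for `m` the size of the connected ideal `J`. -/
noncomputable def idealWeight (J : ConnIdeal P) : RatFunc ℚ := q ^ J.1.card / qBracket J.1.card

theorem card_ne_zero (J : ConnIdeal P) : J.1.card ≠ 0 :=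
  (card_pos.2 (IsConnIdeal.nonempty J.2)).ne'

theorem one_add_idealWeight (J : ConnIdeal P) : 1 + idealWeight J = 1 / qBracket J.1.card := by
  have h := qBracket_ne_zero (card_ne_zero J)
  unfold idealWeight
  rw [eq_div_iff h, add_mul, div_mul_cancel₀ _ h, qBracket]
  ring

/-- This is what turns the condition of containing all components into a plain power of `q`. -/
theorem idealWeight_eq (J : ConnIdeal P) :
    idealWeight J = q ^ J.1.card * (1 + idealWeight J) := by
  rw [one_add_idealWeight, idealWeight, mul_one_div]

/-! ### Laminar families and their recursion over ideals -/

/-- A family of connected ideals any two of which are disjoint or nested. -/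
def Laminar (N : Finset (ConnIdeal P)) : Prop :=
  ∀ J ∈ N, ∀ K ∈ N, Compatible J.1 K.1

open Classical in
/-- The laminar families of connected ideals contained in `S`. -/
noncomputable def laminarIn (P : PartialOrder (Fin n)) (S : Finset (Fin n)) :
    Finset (Finset (ConnIdeal P)) :=
  univ.filter fun N => Laminar N ∧ ∀ J ∈ N, J.1 ⊆ S

theorem mem_laminarIn {S : Finset (Fin n)} {N : Finset (ConnIdeal P)} :
    N ∈ laminarIn P S ↔ Laminar N ∧ ∀ J ∈ N, J.1 ⊆ S := by
  simp [laminarIn]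

/-- The generating function of multisets supported on laminar families. -/
noncomputable def laminarSum (P : PartialOrder (Fin n)) (S : Finset (Fin n)) : RatFunc ℚ :=
  ∑ N ∈ laminarIn P S, ∏ J ∈ N, idealWeight J

open Classical in
/-- The order ideals of `P` contained in `S`. -/
noncomputable def idealsIn (P : PartialOrder (Fin n)) (S : Finset (Fin n)) :
    Finset (Finset (Fin n)) :=
  S.powerset.filter (IsDown P)

theorem mem_idealsIn {S A : Finset (Fin n)} : A ∈ idealsIn P S ↔ A ⊆ S ∧ IsDown P A := by
  simp [idealsIn]

open Classical in
/-- The connected components of an order ideal. -/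
noncomputable def components (P : PartialOrder (Fin n)) (S : Finset (Fin n)) :
    Finset (ConnIdeal P) :=
  univ.filter fun J => J.1 ⊆ S ∧ IsDown P (S \ J.1)

theorem mem_components {S : Finset (Fin n)} {J : ConnIdeal P} :
    J ∈ components P S ↔ J.1 ⊆ S ∧ IsDown P (S \ J.1) := by
  simp [components]

theorem sum_card_components {S : Finset (Fin n)} (hS : IsDown P S) :
    ∑ J ∈ components P S, J.1.card = S.card := by
  classical
  have h : S = (components P S).biUnion fun J => J.1 := by
    ext x
    simp only [mem_biUnion]
    constructor
    · intro hx
      obtain ⟨J, h1, h2, h3⟩ := exists_component hS hx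
      exact ⟨J, mem_components.2 ⟨h2, h3⟩, h1⟩
    · rintro ⟨J, hJ, hx⟩
      exact (mem_components.1 hJ).1 hx
  conv_rhs => rw [h]
  refine (card_biUnion ?_).symm
  intro J hJ K hK hne
  rw [mem_coe, mem_components] at hJ hK
  refine disjoint_left.2 fun x hxJ hxK => hne (Subtype.ext ?_)
  exact Subset.antisymm (subset_component K.2.isDown hK.2 J.2 hJ.1 hxJ hxK)
    (subset_component J.2.isDown hJ.2 K.2 hK.1 hxK hxJ)

-- A component of `S` contains, or is disjoint from, each connected ideal inside `S`, so its
-- presence in a laminar family is a free choice.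
open Classical in
theorem insert_mem_laminarIn_iff {S : Finset (Fin n)} {T : ConnIdeal P}
    (hT : T ∈ components P S) (N : Finset (ConnIdeal P)) :
    insert T N ∈ laminarIn P S ↔ N ∈ laminarIn P S := by
  rw [mem_components] at hT
  have hc : ∀ J : ConnIdeal P, J.1 ⊆ S → Compatible J.1 T.1 := by
    intro J hJ
    by_cases hd : Disjoint J.1 T.1
    · exact Or.inl hd
    · obtain ⟨x, h1, h2⟩ := not_disjoint_iff.1 hd
      exact Or.inr (Or.inl (subset_component T.2.isDown hT.2 J.2 hJ h1 h2))
  simp only [mem_laminarIn]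
  constructor
  · rintro ⟨h1, h2⟩
    exact ⟨fun J hJ K hK => h1 J (mem_insert_of_mem hJ) K (mem_insert_of_mem hK),
      fun J hJ => h2 J (mem_insert_of_mem hJ)⟩
  · rintro ⟨h1, h2⟩
    have h3 : ∀ J ∈ insert T N, J.1 ⊆ S := by
      intro J hJ
      rcases mem_insert.1 hJ with rfl | hJ
      · exact hT.1
      · exact h2 J hJ
    refine ⟨?_, h3⟩
    intro J hJ K hK
    rcases mem_insert.1 hJ with rfl | hJ'
    · exact (hc K (h3 K hK)).symm
    · rcases mem_insert.1 hK with rfl | hK'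
      · exact hc J (h3 J hJ)
      · exact h1 J hJ' K hK'

theorem biUnion_eq_iff {S : Finset (Fin n)} (hS : IsDown P S) {N : Finset (ConnIdeal P)}
    (hN : N ∈ laminarIn P S) : (N.biUnion fun J => J.1) = S ↔ components P S ⊆ N := by
  obtain ⟨hlam, hsub⟩ := mem_laminarIn.1 hN
  constructor
  · intro hU J hJ
    obtain ⟨hJS, hJc⟩ := mem_components.1 hJ
    obtain ⟨x, hx⟩ := J.2.nonempty
    have hxU : x ∈ N.biUnion fun J => J.1 := hU ▸ hJS hx
    obtain ⟨K0, hK0, hxK0⟩ := mem_biUnion.1 hxU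
    -- By maximality of `K` among the members through `x`, every member meeting `K` lies inside `K`;
    -- hence `K` splits off from `S`.
    obtain ⟨K, hK, hmax⟩ := (N.filter fun K => x ∈ K.1).exists_max_image (fun K => K.1.card)
      ⟨K0, mem_filter.2 ⟨hK0, hxK0⟩⟩
    obtain ⟨hKN, hxK⟩ := mem_filter.1 hK
    have hKJ : K.1 ⊆ J.1 := subset_component J.2.isDown hJc K.2 (hsub K hKN) hxK hx
    have hKc : IsDown P (S \ K.1) := by
      intro y hy z hz
      obtain ⟨hyS, hyK⟩ := mem_sdiff.1 hy
      refine mem_sdiff.2 ⟨hS y hyS z hz, fun hzK => ?_⟩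
      rw [← hU] at hyS
      obtain ⟨L, hL, hyL⟩ := mem_biUnion.1 hyS
      have hzL := L.2.isDown y hyL z hz
      rcases (hlam K hKN L hL).nested hzK hzL with h | h
      · have := eq_of_subset_of_card_le h (hmax L (mem_filter.2 ⟨hL, h hxK⟩))
        exact hyK (this ▸ hyL)
      · exact hyK (h hyL)
    have hJK : J.1 ⊆ K.1 := subset_component K.2.isDown hKc J.2 hJS hx hxK
    have : J = K := Subtype.ext (Subset.antisymm hJK hKJ)
    exact this ▸ hKN
  · intro hT
    refine Subset.antisymm (biUnion_subset.2 hsub) ?_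
    intro x hx
    obtain ⟨J, h1, h2, h3⟩ := exists_component hS hx
    exact mem_biUnion.2 ⟨J, hT (mem_components.2 ⟨h2, h3⟩), h1⟩

-- These are the families with union `S`. The components being free choices, `idealWeight_eq` makes
-- the proportion of families that choose all of them exactly q^|S|.
open Classical in
theorem sum_laminar_biUnion_eq {S : Finset (Fin n)} (hS : IsDown P S) :
    ∑ N ∈ (laminarIn P S).filter (fun N => components P S ⊆ N), ∏ J ∈ N, idealWeight J =
      q ^ S.card * laminarSum P S := by
  have h := sum_superset_of_insert_mem_iff (laminarIn P S) idealWeight (components P S)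
    (fun t ht N => insert_mem_laminarIn_iff ht N)
  have h1 : ∏ t ∈ components P S, idealWeight t =
      q ^ S.card * ∏ t ∈ components P S, (1 + idealWeight t) := by
    rw [prod_congr rfl fun t _ => idealWeight_eq t, prod_mul_distrib, prod_pow_eq_pow_sum,
      sum_card_components hS]
  have h2 : ∏ t ∈ components P S, (1 + idealWeight t) ≠ 0 := by
    refine prod_ne_zero_iff.2 fun t _ => ?_
    rw [one_add_idealWeight]
    exact one_div_ne_zero (qBracket_ne_zero (card_ne_zero t))
  rw [h1, mul_comm (q ^ S.card), mul_assoc] at h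
  exact mul_left_cancel₀ h2 h

/-- Group the families by their union `A`. For P-partitions, `A` is the support, and q^|A| records
lowering all values on it by one. -/
theorem laminarSum_eq {S : Finset (Fin n)} :
    laminarSum P S = ∑ A ∈ idealsIn P S, q ^ A.card * laminarSum P A := by
  classical
  have hmaps : ∀ N ∈ laminarIn P S, (N.biUnion fun J => J.1) ∈ idealsIn P S := by
    intro N hN
    refine mem_idealsIn.2 ⟨biUnion_subset.2 (mem_laminarIn.1 hN).2, ?_⟩
    intro i hi j hj
    obtain ⟨J, hJ, hiJ⟩ := mem_biUnion.1 hi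
    exact mem_biUnion.2 ⟨J, hJ, J.2.isDown i hiJ j hj⟩
  unfold laminarSum
  rw [← sum_fiberwise_of_maps_to hmaps]
  refine sum_congr rfl fun A hA => ?_
  obtain ⟨hAS, hA⟩ := mem_idealsIn.1 hA
  have := sum_laminar_biUnion_eq hA
  rw [laminarSum] at this
  rw [← this]
  refine sum_congr ?_ fun _ _ => rfl
  ext N
  rw [mem_filter, mem_filter]
  constructor
  · rintro ⟨h1, h2⟩
    have h3 : N ∈ laminarIn P A := by
      refine mem_laminarIn.2 ⟨(mem_laminarIn.1 h1).1, fun J hJ => ?_⟩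
      rw [← h2]
      exact subset_biUnion_of_mem (fun J : ConnIdeal P => J.1) hJ
    exact ⟨h3, (biUnion_eq_iff hA h3).1 h2⟩
  · rintro ⟨h1, h2⟩
    refine ⟨mem_laminarIn.2 ⟨(mem_laminarIn.1 h1).1, fun J hJ => ?_⟩, (biUnion_eq_iff hA h1).2 h2⟩
    exact ((mem_laminarIn.1 h1).2 J hJ).trans hAS

/-! ### The major index over linear extensions -/

/-- The major index of a word. -/
def majWord {k : ℕ} (u : Fin k → Fin n) : ℕ :=
  ∑ p ∈ (Finset.Icc 1 (k - 1)).filter fun p =>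
    ∃ i j : Fin k, (i : ℕ) + 1 = p ∧ (j : ℕ) = p ∧ (u j : ℕ) < (u i : ℕ), p

theorem maj_eq_majWord (w : Equiv.Perm (Fin n)) : maj w = majWord w := rfl

theorem majWord_of_le_one {k : ℕ} (hk : k ≤ 1) (u : Fin k → Fin n) : majWord u = 0 := by
  unfold majWord
  rw [Finset.Icc_eq_empty (by omega)]
  simp

theorem majWord_snoc {k : ℕ} (u : Fin (k + 1) → Fin n) (a : Fin n) :
    majWord (Fin.snoc u a : Fin (k + 2) → Fin n) =
      majWord u + if (a : ℕ) < u (Fin.last k) then k + 1 else 0 := by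
  unfold majWord
  have h1 : k + 2 - 1 = k + 1 := rfl
  have h2 : k + 1 - 1 = k := rfl
  rw [h1, h2, sum_filter, sum_filter, Finset.sum_Icc_succ_top (by omega)]
  congr 1
  · refine sum_congr rfl fun p hp => ?_
    have hp' := mem_Icc.1 hp
    refine if_congr ?_ rfl rfl
    constructor
    · rintro ⟨i, j, hi, hj, h⟩
      obtain ⟨i, rfl⟩ : ∃ l : Fin (k + 1), i = l.castSucc := ⟨⟨i, by omega⟩, rfl⟩
      obtain ⟨j, rfl⟩ : ∃ l : Fin (k + 1), j = l.castSucc := ⟨⟨j, by omega⟩, rfl⟩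
      rw [Fin.snoc_castSucc, Fin.snoc_castSucc] at h
      exact ⟨i, j, hi, hj, h⟩
    · rintro ⟨i, j, hi, hj, h⟩
      refine ⟨i.castSucc, j.castSucc, hi, hj, ?_⟩
      rwa [Fin.snoc_castSucc, Fin.snoc_castSucc]
  · refine if_congr ?_ rfl rfl
    constructor
    · rintro ⟨i, j, hi, hj, h⟩
      have ei : i = Fin.castSucc (Fin.last k) := Fin.ext (by simp; omega)
      have ej : j = Fin.last (k + 1) := Fin.ext (by simp; omega)
      rw [ei, ej, Fin.snoc_castSucc, Fin.snoc_last] at h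
      exact h
    · intro h
      refine ⟨Fin.castSucc (Fin.last k), Fin.last (k + 1), by simp, by simp, ?_⟩
      rw [Fin.snoc_castSucc, Fin.snoc_last]
      exact h

open Classical in
/-- The linear extensions, as words of length `k`, of the order ideal `U` of size `k`. -/
noncomputable def words (P : PartialOrder (Fin n)) (k : ℕ) (U : Finset (Fin n)) :
    Finset (Fin k → Fin n) :=
  univ.filter fun u => Function.Injective u ∧ univ.image u = U ∧
    ∀ i x, P.lt x (u i) → ∃ j < i, u j = x

theorem mem_words {k : ℕ} {U : Finset (Fin n)} {u : Fin k → Fin n} :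
    u ∈ words P k U ↔ Function.Injective u ∧ univ.image u = U ∧
      ∀ i x, P.lt x (u i) → ∃ j < i, u j = x := by
  simp [words]

theorem isDown_of_mem_words {k : ℕ} {U : Finset (Fin n)} {u : Fin k → Fin n}
    (hu : u ∈ words P k U) : IsDown P U := by
  obtain ⟨-, rfl, h⟩ := mem_words.1 hu
  intro i hi j hj
  by_cases hij : j = i
  · exact hij ▸ hi
  · obtain ⟨k, -, rfl⟩ := mem_image.1 hi
    obtain ⟨l, -, rfl⟩ := h k j (@lt_of_le_of_ne _ P _ _ hj hij)
    exact mem_image_of_mem _ (mem_univ _)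

theorem snoc_mem_words_iff {k : ℕ} {U : Finset (Fin n)} (hU : IsDown P U) {v : Fin k → Fin n}
    {b : Fin n} :
    (Fin.snoc v b : Fin (k + 1) → Fin n) ∈ words P (k + 1) U ↔
      b ∈ U ∧ v ∈ words P k (U.erase b) := by
  have himg : univ.image (Fin.snoc v b : Fin (k + 1) → Fin n) = insert b (univ.image v) := by
    ext x
    simp only [mem_image, mem_univ, true_and, mem_insert, Fin.exists_fin_succ', Fin.snoc_castSucc,
      Fin.snoc_last]
    tauto
  have hinj : Function.Injective (Fin.snoc v b : Fin (k + 1) → Fin n) ↔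
      Function.Injective v ∧ b ∉ univ.image v := by
    rw [Fin.snoc_injective_iff]
    simp
  have hcond : (∀ i x, P.lt x ((Fin.snoc v b : Fin (k + 1) → Fin n) i) →
        ∃ j < i, (Fin.snoc v b : Fin (k + 1) → Fin n) j = x) ↔
      (∀ i x, P.lt x (v i) → ∃ j < i, v j = x) ∧ ∀ x, P.lt x b → x ∈ univ.image v := by
    rw [Fin.forall_fin_succ']
    refine and_congr (forall_congr' fun i => forall_congr' fun x => ?_) (forall_congr' fun x => ?_)
    · rw [Fin.snoc_castSucc]
      refine imp_congr_right fun _ => ?_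
      rw [Fin.exists_fin_succ']
      simp only [Fin.snoc_castSucc, Fin.castSucc_lt_castSucc_iff]
      have : ¬ Fin.last k < i.castSucc := (Fin.le_last _).not_gt
      simp only [this, false_and, or_false]
    · rw [Fin.snoc_last]
      refine imp_congr_right fun _ => ?_
      rw [Fin.exists_fin_succ']
      simp [Fin.castSucc_lt_last]
  rw [mem_words, mem_words, himg, hinj, hcond]
  constructor
  · rintro ⟨⟨h1, h2⟩, rfl, h3, h4⟩
    exact ⟨mem_insert_self _ _, h1, (erase_insert h2).symm, h3⟩
  · rintro ⟨hb, h1, h2, h3⟩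
    rw [h2]
    refine ⟨⟨h1, notMem_erase _ _⟩, insert_erase hb, h3, fun x hx => ?_⟩
    exact mem_erase.2 ⟨@ne_of_lt _ P.toPreorder _ _ hx, hU b hb x (@le_of_lt _ P.toPreorder _ _ hx)⟩

open Classical in
/-- The elements of `U` that can come last in a linear extension of `U`. -/
noncomputable def lastElements (P : PartialOrder (Fin n)) (U : Finset (Fin n)) : Finset (Fin n) :=
  U.filter fun b => IsDown P (U.erase b)

theorem mem_lastElements {U : Finset (Fin n)} {b : Fin n} :
    b ∈ lastElements P U ↔ b ∈ U ∧ IsDown P (U.erase b) := by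
  simp [lastElements]

theorem sum_words_succ {K : Type*} [AddCommMonoid K] {k : ℕ} {U : Finset (Fin n)}
    (hU : IsDown P U) (g : (Fin (k + 1) → Fin n) → K) :
    ∑ u ∈ words P (k + 1) U, g u =
      ∑ b ∈ lastElements P U, ∑ v ∈ words P k (U.erase b), g (Fin.snoc v b) := by
  rw [sum_sigma']
  refine (Finset.sum_bij' (fun s _ => Fin.snoc s.2 s.1)
    (fun u _ => ⟨u (Fin.last k), Fin.init u⟩) ?_ ?_ ?_ ?_ ?_).symm
  · rintro ⟨b, v⟩ h
    obtain ⟨h1, h2⟩ := mem_sigma.1 h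
    exact (snoc_mem_words_iff hU).2 ⟨(mem_lastElements.1 h1).1, h2⟩
  · intro u hu
    have hu' := hu
    rw [← Fin.snoc_init_self u, snoc_mem_words_iff hU] at hu'
    exact mem_sigma.2 ⟨mem_lastElements.2 ⟨hu'.1, isDown_of_mem_words hu'.2⟩, hu'.2⟩
  · rintro ⟨b, v⟩ _
    simp
  · intro u _
    exact Fin.snoc_init_self u
  · intro s _
    rfl

/-- Each `A ≠ U` is filed under the largest label `b` of `U \ A`. Elements of `U` above `b` in `P`
would lie outside `A` and have larger labels, so `b` is maximal in `U` and can end a word. As `p`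
passes to smaller labels, it need only be tested at `b`. -/
theorem sum_idealsIn_eq (hP : NaturallyLabeled P) {K : Type*} [AddCommMonoid K]
    {U : Finset (Fin n)} (hU : IsDown P U) (p : Fin n → Prop) [DecidablePred p]
    (hp : ∀ x y : Fin n, (x : ℕ) ≤ y → p y → p x) (g : Finset (Fin n) → K) :
    ∑ A ∈ idealsIn P U with ∀ x ∈ U \ A, p x, g A =
      g U + ∑ b ∈ lastElements P U with p b,
        ∑ A ∈ idealsIn P (U.erase b) with ∀ x ∈ U.erase b \ A, (x : ℕ) < b, g A := by
  classical
  have hmem : U ∈ (idealsIn P U).filter fun A => ∀ x ∈ U \ A, p x := by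
    refine mem_filter.2 ⟨mem_idealsIn.2 ⟨Subset.rfl, hU⟩, fun x hx => ?_⟩
    rw [sdiff_self] at hx
    exact absurd hx (notMem_empty _)
  rw [← add_sum_erase _ _ hmem]
  congr 1
  have h1 : ∀ A ∈ ((idealsIn P U).filter fun A => ∀ x ∈ U \ A, p x).erase U,
      g A = ∑ b ∈ (U \ A).filter (fun b : Fin n => ∀ x ∈ U \ A, (x : ℕ) ≤ b), g A := by
    intro A hA
    obtain ⟨hne, hA⟩ := mem_erase.1 hA
    obtain ⟨hA, -⟩ := mem_filter.1 hA
    have hAU := (mem_idealsIn.1 hA).1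
    have hnon : (U \ A).Nonempty := by
      rw [sdiff_nonempty]
      exact fun h => hne (Subset.antisymm hAU h)
    obtain ⟨m, hm, hmax⟩ := (U \ A).exists_max_image (fun x => (x : ℕ)) hnon
    have : (U \ A).filter (fun b : Fin n => ∀ x ∈ U \ A, (x : ℕ) ≤ b) = {m} := by
      ext b
      rw [mem_filter, mem_singleton]
      constructor
      · rintro ⟨h1, h2⟩
        exact Fin.ext (Nat.le_antisymm (hmax b h1) (h2 m hm))
      · rintro rfl
        exact ⟨hm, hmax⟩
    rw [this, sum_singleton]
  rw [sum_congr rfl h1]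
  refine sum_comm' fun A b => ?_
  simp only [mem_erase, mem_filter, mem_idealsIn, mem_sdiff, mem_lastElements, ne_eq]
  constructor
  · rintro ⟨⟨hne, ⟨hAU, hA⟩, hpA⟩, ⟨hbU, hbA⟩, hmax⟩
    refine ⟨⟨⟨fun x hx => mem_erase.2 ⟨fun h => hbA (h ▸ hx), hAU hx⟩, hA⟩, ?_⟩, ⟨hbU, ?_⟩,
      hpA b ⟨hbU, hbA⟩⟩
    · rintro x ⟨⟨hxb, hxU⟩, hxA⟩
      exact Nat.lt_of_le_of_ne (hmax x ⟨hxU, hxA⟩) fun h => hxb (Fin.ext h)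
    · intro y hy z hz
      obtain ⟨hyb, hyU⟩ := mem_erase.1 hy
      refine mem_erase.2 ⟨?_, hU y hyU z hz⟩
      rintro rfl
      have hyA : y ∉ A := fun h => hbA (hA y h z hz)
      have h2 := hmax y ⟨hyU, hyA⟩
      have h3 := hP z y (@lt_of_le_of_ne _ P _ _ hz (Ne.symm hyb))
      exact absurd h3 (Nat.not_lt.2 h2)
  · rintro ⟨⟨⟨hAe, hA⟩, hlt⟩, ⟨hbU, hb⟩, hpb⟩
    have hbA : b ∉ A := fun h => notMem_erase b U (hAe h)
    have hle : ∀ x, x ∈ U ∧ x ∉ A → (x : ℕ) ≤ b := by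
      rintro x ⟨hxU, hxA⟩
      by_cases hxb : x = b
      · exact hxb ▸ Nat.le_refl _
      · exact (hlt x ⟨⟨hxb, hxU⟩, hxA⟩).le
    exact ⟨⟨fun h => hbA (h ▸ hbU), ⟨hAe.trans (erase_subset _ _), hA⟩,
      fun x hx => hp x b (hle x hx) hpb⟩, ⟨hbU, hbA⟩, hle⟩

/-- The part of the sum `laminarSum_eq` over the ideals `A` of `U` with `U \ A` below `a`. -/
noncomputable def partialSum (P : PartialOrder (Fin n)) (U : Finset (Fin n)) (a : Fin n) :
    RatFunc ℚ :=
  ∑ A ∈ idealsIn P U with ∀ x ∈ U \ A, (x : ℕ) < a, q ^ A.card * laminarSum P A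

theorem partialSum_eq (hP : NaturallyLabeled P) {U : Finset (Fin n)} (hU : IsDown P U)
    (a : Fin n) :
    partialSum P U a = q ^ U.card * laminarSum P U +
      ∑ b ∈ (lastElements P U).filter (fun b : Fin n => (b : ℕ) < a), partialSum P (U.erase b) b :=
  sum_idealsIn_eq hP hU (fun x => (x : ℕ) < a) (fun _ _ h h' => Nat.lt_of_le_of_lt h h') _

/-- Without a bound on the labels the left side of `sum_idealsIn_eq` is `laminarSum P U` itself; its
term `A = U` is then moved to the left. -/
theorem qBracket_mul_laminarSum (hP : NaturallyLabeled P) {U : Finset (Fin n)}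
    (hU : IsDown P U) :
    qBracket U.card * laminarSum P U =
      ∑ b ∈ lastElements P U, partialSum P (U.erase b) b := by
  have h := sum_idealsIn_eq hP hU (fun _ => True) (fun _ _ _ _ => trivial)
    (fun A => q ^ A.card * laminarSum P A)
  simp only [implies_true, filter_true] at h
  rw [← laminarSum_eq] at h
  rw [qBracket, sub_mul, one_mul, sub_eq_iff_eq_add']
  exact h

theorem laminarSum_empty : laminarSum P ∅ = 1 := by
  have : laminarIn P ∅ = {∅} := by
    ext N
    rw [mem_laminarIn, mem_singleton]
    constructor
    · rintro ⟨-, h⟩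
      refine eq_empty_of_forall_notMem fun J hJ => ?_
      exact (IsConnIdeal.nonempty J.2).ne_empty (subset_empty.1 (h J hJ))
    · rintro rfl
      exact ⟨by simp [Laminar], by simp⟩
  rw [laminarSum, this, sum_singleton, prod_empty]

theorem qFactorial_succ (k : ℕ) : qFactorial (k + 1) = qFactorial k * qBracket (k + 1) := by
  rw [qFactorial, qFactorial, prod_Icc_succ_top (by omega)]

theorem qFactorial_zero : qFactorial 0 = 1 := by
  simp [qFactorial]

theorem words_zero : words P 0 ∅ = univ := by
  ext u
  rw [mem_words]
  exact ⟨fun _ => mem_univ _, fun _ => ⟨fun i => i.elim0, by simp, fun i => i.elim0⟩⟩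

/-- The extra letter `a` makes the induction close: whether the last letter of `u` starts a descent
is decided by `a`, and `partialSum` records just this comparison. -/
theorem sum_words_majWord_snoc (hP : NaturallyLabeled P) (k : ℕ) :
    ∀ U : Finset (Fin n), IsDown P U → U.card = k → ∀ a, a ∉ U →
      ∑ u ∈ words P k U, q ^ majWord (Fin.snoc u a : Fin (k + 1) → Fin n) =
        qFactorial k * partialSum P U a := by
  induction k with
  | zero =>
    intro U _ hcard a _
    obtain rfl := card_eq_zero.1 hcard
    have hlast : lastElements P ∅ = ∅ :=
      eq_empty_of_forall_notMem fun b hb => notMem_empty _ (mem_lastElements.1 hb).1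
    rw [partialSum_eq hP isDown_empty, words_zero, hlast, filter_empty]
    simp [majWord_of_le_one, laminarSum_empty, qFactorial_zero]
  | succ k ih =>
    intro U hU hcard a ha
    have h1 : ∀ b ∈ lastElements P U, ∑ v ∈ words P k (U.erase b),
        q ^ majWord (Fin.snoc (Fin.snoc v b : Fin (k + 1) → Fin n) a : Fin (k + 2) → Fin n) =
        qFactorial k * ((if (a : ℕ) < b then q ^ (k + 1) else 1) * partialSum P (U.erase b) b) := by
      intro b hb
      obtain ⟨hbU, hb⟩ := mem_lastElements.1 hb
      have h2 := ih (U.erase b) hb (by rw [card_erase_of_mem hbU, hcard]; rfl) b (notMem_erase _ _)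
      rw [mul_left_comm, ← h2, mul_sum]
      refine sum_congr rfl fun v _ => ?_
      rw [majWord_snoc, Fin.snoc_last, pow_add, mul_comm]
      congr 1
      split_ifs <;> simp
    rw [sum_words_succ hU, sum_congr rfl h1, ← mul_sum, qFactorial_succ, mul_assoc]
    congr 1
    -- Multiplied by 1 - q^(k+1), the first term of the recursion becomes q^(k+1) times the sum over
    -- all last letters `b`. In total `b < a` gets coefficient 1 and `b > a` gets q^(k+1), the
    -- contribution of a descent at position k + 1.
    rw [partialSum_eq hP hU, mul_add, hcard, mul_left_comm, ← hcard, qBracket_mul_laminarSum hP hU,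
      hcard, sum_filter, mul_sum, mul_sum, ← sum_add_distrib]
    refine sum_congr rfl fun b hb => ?_
    have hne : (b : ℕ) ≠ a := fun h => ha (Fin.ext h ▸ (mem_lastElements.1 hb).1)
    rcases lt_or_gt_of_ne hne with h | h
    · rw [if_neg h.not_gt, if_pos h, qBracket]
      ring
    · rw [if_pos h, if_neg h.not_gt, qBracket]
      ring

theorem sum_words_majWord (hP : NaturallyLabeled P) {k : ℕ} {U : Finset (Fin n)}
    (hU : IsDown P U) (hcard : U.card = k) :
    ∑ u ∈ words P k U, q ^ majWord u = qFactorial k * laminarSum P U := by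
  cases k with
  | zero =>
    obtain rfl := card_eq_zero.1 hcard
    rw [words_zero]
    simp [majWord_of_le_one, laminarSum_empty, qFactorial_zero]
  | succ k =>
    have h1 : ∀ b ∈ lastElements P U, ∑ v ∈ words P k (U.erase b),
        q ^ majWord (Fin.snoc v b : Fin (k + 1) → Fin n) =
        qFactorial k * partialSum P (U.erase b) b := by
      intro b hb
      obtain ⟨hbU, hb⟩ := mem_lastElements.1 hb
      exact sum_words_majWord_snoc hP k (U.erase b) hb
        (by rw [card_erase_of_mem hbU, hcard]; rfl) b (notMem_erase _ _)
    rw [sum_words_succ hU, sum_congr rfl h1, ← mul_sum, ← qBracket_mul_laminarSum hP hU,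
      qFactorial_succ, hcard, mul_assoc]

theorem coe_mem_words_iff (w : Equiv.Perm (Fin n)) :
    (w : Fin n → Fin n) ∈ words P n univ ↔ w ∈ linearExtensions P := by
  have hl : w ∈ linearExtensions P ↔ IsLinearExtension P w := by simp [linearExtensions]
  rw [mem_words, hl]
  constructor
  · rintro ⟨-, -, h⟩ i j hij
    obtain ⟨l, h1, h2⟩ := h j _ hij
    rw [w.injective h2] at h1
    exact h1
  · intro h
    refine ⟨w.injective, image_univ_of_surjective w.surjective, fun i x hx => ?_⟩
    obtain ⟨l, rfl⟩ := w.surjective x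
    exact ⟨l, h l i hx, rfl⟩

/-- The generating function of the major index over the linear extensions. -/
theorem sum_linearExtensions (hP : NaturallyLabeled P) :
    ∑ w ∈ linearExtensions P, q ^ maj w = qFactorial n * laminarSum P univ := by
  rw [← sum_words_majWord hP isDown_univ (by simp)]
  refine Finset.sum_bij (fun w _ => (w : Fin n → Fin n)) ?_ ?_ ?_ ?_
  · intro w hw
    exact (coe_mem_words_iff w).2 hw
  · intro w _ w' _ h
    exact DFunLike.coe_injective h
  · intro u hu
    have hbij : Function.Bijective u := Finite.injective_iff_bijective.1 (mem_words.1 hu).1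
    exact ⟨Equiv.ofBijective u hbij, (coe_mem_words_iff _).1 hu, rfl⟩
  · intro w _
    rw [maj_eq_majWord]

/-! ### Laminar families of maximum size and their labels -/

theorem laminar_iff_isIndepSet {M : Finset (ConnIdeal P)} :
    Laminar M ↔ (idealGraph P).IsIndepSet (M : Set (ConnIdeal P)) := by
  constructor
  · intro h J hJ K hK _
    exact not_adj_iff.2 (h J hJ K hK)
  · intro h J hJ K hK
    by_cases hne : J = K
    · exact Or.inr (Or.inl (hne ▸ Subset.rfl))
    · exact not_adj_iff.1 (h hJ hK hne)

theorem mem_mu {M : Finset (ConnIdeal P)} {J : ConnIdeal P} {x : Fin n} :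
    x ∈ mu M J ↔ ∃ K ∈ M, K.1 ⊂ J.1 ∧ x ∈ K.1 := by
  simp [mu, and_assoc]

/-- If the members strictly inside `J` covered `J`, the largest of them through some point would
split off from `J`, against connectedness. -/
theorem Laminar.sdiff_mu_nonempty {M : Finset (ConnIdeal P)} (hM : Laminar M) (J : ConnIdeal P) :
    (J.1 \ mu M J).Nonempty := by
  classical
  rw [sdiff_nonempty]
  intro hsub
  obtain ⟨x, hx⟩ := J.2.nonempty
  obtain ⟨K0, hK0, hKJ0, hxK0⟩ := mem_mu.1 (hsub hx)
  obtain ⟨K, hK, hmax⟩ := (M.filter fun K => K.1 ⊂ J.1 ∧ x ∈ K.1).exists_max_image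
    (fun K => K.1.card) ⟨K0, mem_filter.2 ⟨hK0, hKJ0, hxK0⟩⟩
  obtain ⟨hKM, hKJ, hxK⟩ := mem_filter.1 hK
  have hdown : IsDown P (J.1 \ K.1) := by
    intro y hy z hz
    obtain ⟨hyJ, hyK⟩ := mem_sdiff.1 hy
    refine mem_sdiff.2 ⟨J.2.isDown y hyJ z hz, fun hzK => ?_⟩
    obtain ⟨L, hL, hLJ, hyL⟩ := mem_mu.1 (hsub hyJ)
    rcases (hM K hKM L hL).nested hzK (L.2.isDown y hyL z hz) with h | h
    · have := eq_of_subset_of_card_le h (hmax L (mem_filter.2 ⟨hL, hLJ, h hxK⟩))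
      exact hyK (this ▸ hyL)
    · exact hyK (h hyL)
  exact hKJ.2 (subset_component K.2.isDown hdown J.2 Subset.rfl hx hxK)

/-- An element of `J.1 \ mu M J` has `J` as the smallest member of `M` containing it. -/
theorem Laminar.subset_of_mem {M : Finset (ConnIdeal P)} (hM : Laminar M) {J K : ConnIdeal P}
    (hJ : J ∈ M) (hK : K ∈ M) {x : Fin n} (hxJ : x ∈ J.1 \ mu M J) (hxK : x ∈ K.1) :
    J.1 ⊆ K.1 := by
  obtain ⟨h1, h2⟩ := mem_sdiff.1 hxJ
  rcases (hM J hJ K hK).nested h1 hxK with h | h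
  · exact h
  · by_contra hne
    exact h2 (mem_mu.2 ⟨K, hK, ⟨h, hne⟩, hxK⟩)

theorem Laminar.eq_of_mem {M : Finset (ConnIdeal P)} (hM : Laminar M) {J K : ConnIdeal P}
    (hJ : J ∈ M) (hK : K ∈ M) {x : Fin n} (hxJ : x ∈ J.1 \ mu M J) (hxK : x ∈ K.1 \ mu M K) :
    J = K :=
  Subtype.ext (Subset.antisymm (hM.subset_of_mem hJ hK hxJ (mem_sdiff.1 hxK).1)
    (hM.subset_of_mem hK hJ hxK (mem_sdiff.1 hxJ).1))

theorem Laminar.exists_label {M : Finset (ConnIdeal P)} (hM : Laminar M) :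
    ∃ g : ConnIdeal P → Fin n, (∀ J, g J ∈ J.1 \ mu M J) ∧ Set.InjOn g M := by
  choose g hg using hM.sdiff_mu_nonempty
  exact ⟨g, hg, fun J hJ K hK h => hM.eq_of_mem hJ hK (hg J) (h ▸ hg K)⟩

theorem Laminar.card_le {M : Finset (ConnIdeal P)} (hM : Laminar M) : M.card ≤ n := by
  obtain ⟨g, -, hg⟩ := hM.exists_label
  simpa using card_le_card_of_injOn g (fun _ _ => mem_univ _) hg

/-- A laminar family of the largest possible size. -/
structure IsFull (M : Finset (ConnIdeal P)) : Prop where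
  laminar : Laminar M
  card_eq : M.card = n

/-- Pigeonhole: representatives of the n disjoint nonempty sets `J.1 \ mu M J` already exhaust the n
elements. -/
theorem IsFull.exists_sdiff_mu_eq' {M : Finset (ConnIdeal P)} (hM : IsFull M) (i : Fin n) :
    ∃ J ∈ M, J.1 \ mu M J = {i} := by
  obtain ⟨g, hg, hinj⟩ := hM.laminar.exists_label
  have himg : M.image g = univ := by
    rw [← card_eq_iff_eq_univ, card_image_of_injOn hinj, hM.card_eq, Fintype.card_fin]
  have hi : i ∈ M.image g := himg ▸ mem_univ i
  obtain ⟨J, hJ, rfl⟩ := mem_image.1 hi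
  refine ⟨J, hJ, eq_singleton_iff_unique_mem.2 ⟨hg J, fun x hx => ?_⟩⟩
  have hx' : x ∈ M.image g := himg ▸ mem_univ x
  obtain ⟨K, hK, rfl⟩ := mem_image.1 hx'
  rw [hM.laminar.eq_of_mem hJ hK hx (hg K)]

theorem IsFull.exists_sdiff_mu_eq {M : Finset (ConnIdeal P)} (hM : IsFull M) {J : ConnIdeal P}
    (hJ : J ∈ M) : ∃ i, J.1 \ mu M J = {i} := by
  obtain ⟨x, hx⟩ := hM.laminar.sdiff_mu_nonempty J
  obtain ⟨K, hK, hKx⟩ := hM.exists_sdiff_mu_eq' x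
  have : J = K := hM.laminar.eq_of_mem hJ hK hx (by rw [hKx]; exact mem_singleton_self x)
  exact ⟨x, this ▸ hKx⟩

theorem Laminar.subset_of_sdiff_mu_eq {M : Finset (ConnIdeal P)} (hM : Laminar M)
    {J K : ConnIdeal P} (hJ : J ∈ M) (hK : K ∈ M) {i : Fin n} (hi : J.1 \ mu M J = {i})
    (hiK : i ∈ K.1) : J.1 ⊆ K.1 :=
  hM.subset_of_mem hJ hK (by rw [hi]; exact mem_singleton_self i) hiK

/-! ### The canonical completion of a laminar family -/

open Classical in
/-- The number of members of `N` that contain `i`. -/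
noncomputable def height (N : Finset (ConnIdeal P)) (i : Fin n) : ℕ :=
  (N.filter fun J => i ∈ J.1).card

/-- A key that sorts the elements by decreasing height, then by increasing label. -/
noncomputable def key (N : Finset (ConnIdeal P)) (i : Fin n) : ℕ :=
  (N.card - height N i) * n + i

theorem height_le_card (N : Finset (ConnIdeal P)) (i : Fin n) : height N i ≤ N.card :=
  card_filter_le _ _

theorem key_lt_of_height_lt {N : Finset (ConnIdeal P)} {i j : Fin n}
    (h : height N j < height N i) : key N i < key N j := by
  have h1 := height_le_card N i
  have h2 : N.card - height N i + 1 ≤ N.card - height N j := by omega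
  have h3 := Nat.mul_le_mul_right n h2
  have h4 := i.isLt
  unfold key
  rw [Nat.add_mul] at h3
  omega

theorem height_le_of_key_le {N : Finset (ConnIdeal P)} {i j : Fin n}
    (h : key N i ≤ key N j) : height N j ≤ height N i := by
  by_contra hlt
  have := key_lt_of_height_lt (Nat.lt_of_not_le hlt)
  omega

theorem key_le_iff_of_height_eq {N : Finset (ConnIdeal P)} {i j : Fin n}
    (h : height N i = height N j) : key N i ≤ key N j ↔ (i : ℕ) ≤ j := by
  unfold key
  rw [h]
  omega

theorem key_injective (N : Finset (ConnIdeal P)) : Function.Injective (key N) := by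
  intro i j h
  have h1 := Nat.le_antisymm (height_le_of_key_le h.ge) (height_le_of_key_le h.le)
  exact Fin.ext (Nat.le_antisymm ((key_le_iff_of_height_eq h1).1 h.le)
    ((key_le_iff_of_height_eq h1.symm).1 h.ge))

theorem height_mono {N : Finset (ConnIdeal P)} {i j : Fin n}
    (h : ∀ J ∈ N, j ∈ J.1 → i ∈ J.1) : height N j ≤ height N i := by
  refine card_le_card fun J hJ => ?_
  obtain ⟨h1, h2⟩ := mem_filter.1 hJ
  exact mem_filter.2 ⟨h1, h J h1 h2⟩

theorem height_strictMono {N : Finset (ConnIdeal P)} {i j : Fin n}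
    (h : ∀ J ∈ N, j ∈ J.1 → i ∈ J.1) {J : ConnIdeal P} (hJ : J ∈ N) (hi : i ∈ J.1)
    (hj : j ∉ J.1) : height N j < height N i := by
  refine card_lt_card ⟨fun K hK => ?_, fun hsub => ?_⟩
  · obtain ⟨h1, h2⟩ := mem_filter.1 hK
    exact mem_filter.2 ⟨h1, h K h1 h2⟩
  · exact hj (mem_filter.1 (hsub (mem_filter.2 ⟨hJ, hi⟩))).2

open Classical in
/-- The elements whose key is at most the key of `i`. -/
noncomputable def below (N : Finset (ConnIdeal P)) (i : Fin n) : Finset (Fin n) :=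
  univ.filter fun x => key N x ≤ key N i

theorem mem_below {N : Finset (ConnIdeal P)} {i x : Fin n} :
    x ∈ below N i ↔ key N x ≤ key N i := by
  simp [below]

/-- An element lower in `P` lies in at least as many members, and natural labeling settles ties.
Hence the initial segments of the key order are ideals. -/
theorem key_le_of_le (hP : NaturallyLabeled P) (N : Finset (ConnIdeal P)) {x y : Fin n}
    (h : P.le y x) : key N y ≤ key N x := by
  by_cases hyx : y = x
  · exact hyx ▸ Nat.le_refl _
  have h1 : height N x ≤ height N y := height_mono fun J _ hx => J.2.isDown x hx y h
  rcases Nat.lt_or_eq_of_le h1 with h2 | h2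
  · exact (key_lt_of_height_lt h2).le
  · exact (key_le_iff_of_height_eq h2.symm).2 (hP y x (@lt_of_le_of_ne _ P _ _ h hyx)).le

theorem isDown_below (hP : NaturallyLabeled P) (N : Finset (ConnIdeal P)) (i : Fin n) :
    IsDown P (below N i) := fun _ hx _ hy =>
  mem_below.2 ((key_le_of_le hP N hy).trans (mem_below.1 hx))

/-- The component that contains `i` of the ideal of the elements with key at most that of `i`. -/
noncomputable def canonIdeal (hP : NaturallyLabeled P) (N : Finset (ConnIdeal P)) (i : Fin n) :
    ConnIdeal P :=
  (exists_component (isDown_below hP N i) (mem_below.2 le_rfl)).choose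

theorem canonIdeal_spec (hP : NaturallyLabeled P) (N : Finset (ConnIdeal P)) (i : Fin n) :
    i ∈ (canonIdeal hP N i).1 ∧ (canonIdeal hP N i).1 ⊆ below N i ∧
      IsDown P (below N i \ (canonIdeal hP N i).1) :=
  (exists_component (isDown_below hP N i) (mem_below.2 le_rfl)).choose_spec

theorem self_mem_canonIdeal (hP : NaturallyLabeled P) (N : Finset (ConnIdeal P)) (i : Fin n) :
    i ∈ (canonIdeal hP N i).1 := (canonIdeal_spec hP N i).1

theorem key_le_of_mem_canonIdeal {hP : NaturallyLabeled P} {N : Finset (ConnIdeal P)}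
    {i x : Fin n} (h : x ∈ (canonIdeal hP N i).1) : key N x ≤ key N i :=
  mem_below.1 ((canonIdeal_spec hP N i).2.1 h)

theorem subset_canonIdeal (hP : NaturallyLabeled P) (N : Finset (ConnIdeal P)) {i x : Fin n}
    {K : ConnIdeal P} (hK : ∀ y ∈ K.1, key N y ≤ key N i) (hxK : x ∈ K.1)
    (hx : x ∈ (canonIdeal hP N i).1) : K.1 ⊆ (canonIdeal hP N i).1 :=
  subset_component (canonIdeal hP N i).2.isDown (canonIdeal_spec hP N i).2.2 K.2
    (fun y hy => mem_below.2 (hK y hy)) hxK hx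

theorem canonIdeal_subset (hP : NaturallyLabeled P) (N : Finset (ConnIdeal P)) {i : Fin n}
    {K : ConnIdeal P} (hi : i ∈ K.1)
    (hK : ∀ y z, key N y ≤ key N i → y ∉ K.1 → P.le z y → z ∉ K.1) :
    (canonIdeal hP N i).1 ⊆ K.1 := by
  refine subset_component K.2.isDown (I := below N i) ?_ (canonIdeal hP N i).2
    (canonIdeal_spec hP N i).2.1 (self_mem_canonIdeal hP N i) hi
  intro y hy z hz
  obtain ⟨h1, h2⟩ := mem_sdiff.1 hy
  exact mem_sdiff.2 ⟨isDown_below hP N i y h1 z hz, hK y z (mem_below.1 h1) h2 hz⟩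

theorem canonIdeal_injective (hP : NaturallyLabeled P) (N : Finset (ConnIdeal P)) :
    Function.Injective (canonIdeal hP N) := by
  intro i j h
  refine key_injective N (Nat.le_antisymm ?_ ?_)
  · exact key_le_of_mem_canonIdeal (hP := hP) (h ▸ self_mem_canonIdeal hP N i)
  · exact key_le_of_mem_canonIdeal (hP := hP) (h ▸ self_mem_canonIdeal hP N j)

open Classical in
/-- The full laminar family obtained by adding the elements one by one in the order of keys. -/
noncomputable def canon (hP : NaturallyLabeled P) (N : Finset (ConnIdeal P)) :
    Finset (ConnIdeal P) :=
  univ.image (canonIdeal hP N)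

theorem mem_canon {hP : NaturallyLabeled P} {N : Finset (ConnIdeal P)} {J : ConnIdeal P} :
    J ∈ canon hP N ↔ ∃ i, canonIdeal hP N i = J := by
  simp [canon]

/-- Components of nested ideals are disjoint or nested. The n ideals are distinct because `i` has
the largest key in its own. -/
theorem isFull_canon (hP : NaturallyLabeled P) (N : Finset (ConnIdeal P)) :
    IsFull (canon hP N) := by
  have key : ∀ i j, key N i ≤ key N j →
      Compatible (canonIdeal hP N i).1 (canonIdeal hP N j).1 := by
    intro i j hij
    by_cases hd : Disjoint (canonIdeal hP N i).1 (canonIdeal hP N j).1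
    · exact Or.inl hd
    · obtain ⟨x, h1, h2⟩ := not_disjoint_iff.1 hd
      exact Or.inr (Or.inl (subset_canonIdeal hP N
        (fun y hy => (key_le_of_mem_canonIdeal hy).trans hij) h1 h2))
  constructor
  · intro J hJ K hK
    obtain ⟨i, rfl⟩ := mem_canon.1 hJ
    obtain ⟨j, rfl⟩ := mem_canon.1 hK
    rcases Nat.le_total (ConnectedOrderIdeals.key N i) (ConnectedOrderIdeals.key N j) with h | h
    · exact key i j h
    · exact (key j i h).symm
  · rw [canon, card_image_of_injective _ (canonIdeal_injective hP N), card_univ, Fintype.card_fin]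

theorem canonIdeal_sdiff_mu (hP : NaturallyLabeled P) (N : Finset (ConnIdeal P)) (i : Fin n) :
    (canonIdeal hP N i).1 \ mu (canon hP N) (canonIdeal hP N i) = {i} := by
  obtain ⟨x, hx⟩ := (isFull_canon hP N).exists_sdiff_mu_eq (mem_canon.2 ⟨i, rfl⟩)
  have hi : i ∈ (canonIdeal hP N i).1 \ mu (canon hP N) (canonIdeal hP N i) := by
    refine mem_sdiff.2 ⟨self_mem_canonIdeal hP N i, fun h => ?_⟩
    obtain ⟨K, hK, hKi, hiK⟩ := mem_mu.1 h
    obtain ⟨k, rfl⟩ := mem_canon.1 hK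
    have h1 := key_le_of_mem_canonIdeal hiK
    have h2 := key_le_of_mem_canonIdeal (hKi.1 (self_mem_canonIdeal hP N k))
    rw [key_injective N (Nat.le_antisymm h1 h2)] at hKi
    exact hKi.2 Subset.rfl
  rw [hx, mem_singleton] at hi
  rw [hx, hi]

/-- `J` is the ideal attached to its element `t` of largest key. A member of `N` through some `y`
outside `J` lying above an element of `J` must contain `J`, hence `t`; since `J` itself contains `t`
but not `y`, the height of `y` is smaller and its key larger. So `J` splits off among the keys up to
that of `t`. -/
theorem subset_canon (hP : NaturallyLabeled P) {N : Finset (ConnIdeal P)} (hN : Laminar N) :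
    N ⊆ canon hP N := by
  intro J hJ
  obtain ⟨t, ht, hmax⟩ := J.1.exists_max_image (key N) J.2.nonempty
  refine mem_canon.2 ⟨t, Subtype.ext (Subset.antisymm ?_ ?_)⟩
  · refine canonIdeal_subset hP N ht fun y z hy hyJ hzy hzJ => ?_
    have h1 : height N y < height N t := by
      refine height_strictMono (fun K hK hyK => ?_) hJ ht hyJ
      rcases (hN J hJ K hK).nested hzJ (K.2.isDown y hyK z hzy) with h | h
      · exact h ht
      · exact absurd (h hyK) hyJ
    exact absurd (key_lt_of_height_lt h1) (Nat.not_lt.2 hy)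
  · exact subset_canonIdeal hP N hmax ht (self_mem_canonIdeal hP N t)

/-! ### Descents and the partition into Boolean intervals -/

/-- The vertex of the forest of `M` given by `J` is a descent: its label exceeds the label of
its parent. -/
def IsDescent (M : Finset (ConnIdeal P)) (J : ConnIdeal P) : Prop :=
  ∃ K ∈ M, J.1 ⊂ K.1 ∧ (∀ L ∈ M, J.1 ⊂ L.1 → ¬ L.1 ⊂ K.1) ∧
    ∃ i j : Fin n, J.1 \ mu M J = {i} ∧ K.1 \ mu M K = {j} ∧ (j : ℕ) < i

open Classical in
/-- The descents of `M`. -/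
noncomputable def descents (M : Finset (ConnIdeal P)) : Finset (ConnIdeal P) :=
  M.filter (IsDescent M)

theorem mem_descents {M : Finset (ConnIdeal P)} {J : ConnIdeal P} :
    J ∈ descents M ↔ J ∈ M ∧ IsDescent M J := by
  simp [descents]

/-- The parent has the larger key but the smaller label, so its height is strictly smaller: some
member of `N` contains the label of `J` but not that of the parent. It contains `J`, and having no
room strictly between `J` and the parent it equals `J`. -/
theorem descents_canon_subset (hP : NaturallyLabeled P) {N : Finset (ConnIdeal P)}
    (hN : Laminar N) : descents (canon hP N) ⊆ N := by
  intro J hJ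
  have hlam := (isFull_canon hP N).laminar
  obtain ⟨hJM, K, hK, hJK, hcov, i, j, hi, hj, hij⟩ := mem_descents.1 hJ
  obtain ⟨i', rfl⟩ := mem_canon.1 hJM
  obtain ⟨j', rfl⟩ := mem_canon.1 hK
  rw [canonIdeal_sdiff_mu, singleton_inj] at hi hj
  subst hi hj
  have hiJ := self_mem_canonIdeal hP N i'
  have hkey := key_le_of_mem_canonIdeal (hJK.1 hiJ)
  have h1 : height N j' < height N i' := by
    refine Nat.lt_of_le_of_ne (height_le_of_key_le hkey) fun h => ?_
    exact absurd ((key_le_iff_of_height_eq h.symm).1 hkey) (Nat.not_le.2 hij)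
  have h2 : ∃ L ∈ N, i' ∈ L.1 ∧ j' ∉ L.1 := by
    by_contra hcon
    push Not at hcon
    exact absurd (height_mono hcon) (Nat.not_le.2 h1)
  obtain ⟨L, hL, hiL, hjL⟩ := h2
  have hLM := subset_canon hP hN hL
  have hJL := hlam.subset_of_sdiff_mu_eq hJM hLM (canonIdeal_sdiff_mu hP N i') hiL
  by_cases hLJ : L.1 ⊆ (canonIdeal hP N i').1
  · have : canonIdeal hP N i' = L := Subtype.ext (Subset.antisymm hJL hLJ)
    exact this ▸ hL
  · exfalso
    rcases (hlam _ hLM _ hK).nested hiL (hJK.1 hiJ) with h | h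
    · exact hcov L hLM ⟨hJL, hLJ⟩ ⟨h, fun h' => hjL (h' (self_mem_canonIdeal hP N j'))⟩
    · exact hjL (h (self_mem_canonIdeal hP N j'))

/-- Height cannot grow from `J` to its parent. At a descent it drops strictly, as `J` itself is in
`N`; elsewhere a tie is settled by the labels. -/
theorem key_lt_of_cover {M N : Finset (ConnIdeal P)} (hM : IsFull M) (hNM : N ⊆ M)
    (hdes : descents M ⊆ N) {J K : ConnIdeal P} (hJ : J ∈ M) (hK : K ∈ M) (hJK : J.1 ⊂ K.1)
    (hcov : ∀ L ∈ M, J.1 ⊂ L.1 → ¬ L.1 ⊂ K.1) {i j : Fin n} (hi : J.1 \ mu M J = {i})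
    (hj : K.1 \ mu M K = {j}) : key N i < key N j := by
  have hiJ := (mem_and_notMem_of_sdiff hi).1
  have hjJ : j ∉ J.1 := fun h => hJK.2 (hM.laminar.subset_of_sdiff_mu_eq hK hJ hj h)
  have hmono : ∀ L ∈ N, j ∈ L.1 → i ∈ L.1 := fun L hL hjL =>
    hM.laminar.subset_of_sdiff_mu_eq hK (hNM hL) hj hjL (hJK.1 hiJ)
  by_cases hd : (j : ℕ) < i
  · exact key_lt_of_height_lt (height_strictMono hmono
      (hdes (mem_descents.2 ⟨hJ, K, hK, hJK, hcov, i, j, hi, hj, hd⟩)) hiJ hjJ)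
  · rcases Nat.lt_or_eq_of_le (height_mono hmono) with h | h
    · exact key_lt_of_height_lt h
    · refine Nat.lt_of_le_of_ne ((key_le_iff_of_height_eq h.symm).2 (Nat.not_lt.1 hd)) fun h' => ?_
      exact hjJ (key_injective N h' ▸ hiJ)

theorem key_lt_of_ssubset {M N : Finset (ConnIdeal P)} (hM : IsFull M) (hNM : N ⊆ M)
    (hdes : descents M ⊆ N) {K : ConnIdeal P} (hK : K ∈ M) {j : Fin n}
    (hj : K.1 \ mu M K = {j}) (m : ℕ) :
    ∀ J ∈ M, ∀ i, K.1.card - J.1.card = m → J.1 ⊂ K.1 → J.1 \ mu M J = {i} →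
      key N i < key N j := by
  classical
  induction m using Nat.strong_induction_on with
  | _ m ih =>
    intro J hJ i hm hJK hi
    have hiJ := (mem_and_notMem_of_sdiff hi).1
    -- The members above `J` form a chain, so the smallest of them is the parent of `J`.
    obtain ⟨L, hL, hmin⟩ := (M.filter fun L => J.1 ⊂ L.1).exists_min_image (fun L => L.1.card)
      ⟨K, mem_filter.2 ⟨hK, hJK⟩⟩
    obtain ⟨hLM, hJL⟩ := mem_filter.1 hL
    obtain ⟨l, hl⟩ := hM.exists_sdiff_mu_eq hLM
    have hcov : ∀ L' ∈ M, J.1 ⊂ L'.1 → ¬ L'.1 ⊂ L.1 := fun L' hL' h1 h2 =>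
      absurd (card_lt_card h2) (Nat.not_lt.2 (hmin L' (mem_filter.2 ⟨hL', h1⟩)))
    have h1 := key_lt_of_cover hM hNM hdes hJ hLM hJL hcov hi hl
    have hLK : L.1 ⊆ K.1 := by
      rcases (hM.laminar L hLM K hK).nested (hJL.1 hiJ) (hJK.1 hiJ) with h | h
      · exact h
      · exact (eq_of_subset_of_card_le h (hmin K (mem_filter.2 ⟨hK, hJK⟩))).ge
    by_cases hKL : K.1 ⊆ L.1
    · have : L = K := Subtype.ext (Subset.antisymm hLK hKL)
      subst this
      rw [hl, singleton_inj] at hj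
      exact hj ▸ h1
    · have h2 := card_lt_card hJL
      have h3 := card_le_card hLK
      exact h1.trans (ih _ (by omega) L hLM l rfl ⟨hLK, hKL⟩ hl)

/-- Keys for `N` increase along the forest of `M`. Therefore each `J` in `M` is the component of its
label `i` among the elements of key at most that of `i`, which is the ideal that `canon` attaches to
`i`. -/
theorem eq_canon (hP : NaturallyLabeled P) {M N : Finset (ConnIdeal P)} (hM : IsFull M)
    (hNM : N ⊆ M) (hdes : descents M ⊆ N) : M = canon hP N := by
  refine eq_of_subset_of_card_le (fun J hJ => ?_) ?_
  · obtain ⟨i, hi⟩ := hM.exists_sdiff_mu_eq hJ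
    have hiJ := (mem_and_notMem_of_sdiff hi).1
    refine mem_canon.2 ⟨i, Subtype.ext (Subset.antisymm ?_ ?_)⟩
    · refine canonIdeal_subset hP N hiJ fun y z hy hyJ hzy hzJ => ?_
      obtain ⟨K, hK, hKy⟩ := hM.exists_sdiff_mu_eq' y
      have hyK := (mem_and_notMem_of_sdiff hKy).1
      rcases (hM.laminar J hJ K hK).nested hzJ (K.2.isDown y hyK z hzy) with h | h
      · have := key_lt_of_ssubset hM hNM hdes hK hKy _ J hJ i rfl ⟨h, fun h' => hyJ (h' hyK)⟩ hi
        exact absurd this (Nat.not_lt.2 hy)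
      · exact hyJ (h hyK)
    · refine subset_canonIdeal hP N (fun x hx => ?_) hiJ (self_mem_canonIdeal hP N i)
      obtain ⟨K, hK, hKx⟩ := hM.exists_sdiff_mu_eq' x
      have hKJ := hM.laminar.subset_of_sdiff_mu_eq hK hJ hKx hx
      by_cases hJK : J.1 ⊆ K.1
      · have : K = J := Subtype.ext (Subset.antisymm hKJ hJK)
        subst this
        rw [hi, singleton_inj] at hKx
        exact hKx ▸ le_rfl
      · exact (key_lt_of_ssubset hM hNM hdes hJ hi _ K hK x rfl ⟨hKJ, hJK⟩ hKx).le
  · rw [hM.card_eq, (isFull_canon hP N).card_eq]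

/-- No laminar family exceeds n members, and the completion of the empty family attains n. -/
theorem isFull_iff (hP : NaturallyLabeled P) {M : Finset (ConnIdeal P)} :
    IsFull M ↔ (idealGraph P).IsMaximumIndepSet M := by
  constructor
  · intro h
    refine ⟨laminar_iff_isIndepSet.1 h.laminar, fun T hT => ?_⟩
    rw [h.card_eq]
    exact (laminar_iff_isIndepSet.2 hT).card_le
  · intro h
    have h1 : Laminar M := laminar_iff_isIndepSet.2 h.isIndepSet
    have h2 := isFull_canon hP (∅ : Finset (ConnIdeal P))
    have h3 := h.maximum _ (laminar_iff_isIndepSet.1 h2.laminar)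
    rw [h2.card_eq] at h3
    exact ⟨h1, Nat.le_antisymm h1.card_le h3⟩

open Classical in
/-- The full laminar families. -/
noncomputable def fullFamilies (P : PartialOrder (Fin n)) : Finset (Finset (ConnIdeal P)) :=
  univ.filter IsFull

theorem mem_fullFamilies {M : Finset (ConnIdeal P)} : M ∈ fullFamilies P ↔ IsFull M := by
  simp [fullFamilies]

theorem sum_Icc_prod {α K : Type*} [DecidableEq α] [CommRing K] (y : α → K) {D M : Finset α}
    (h : D ⊆ M) :
    ∑ N ∈ Icc D M, ∏ J ∈ N, y J = (∏ J ∈ D, y J) * ∏ J ∈ M \ D, (1 + y J) := by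
  rw [prod_one_add, mul_sum, Icc_eq_image_powerset h, sum_image]
  · refine sum_congr rfl fun N hN => ?_
    rw [prod_union (disjoint_of_subset_right (mem_powerset.1 hN) disjoint_sdiff)]
  · intro A hA B hB hAB
    have hA' := disjoint_of_subset_right (mem_powerset.1 hA) (disjoint_sdiff (s := D))
    have hB' := disjoint_of_subset_right (mem_powerset.1 hB) (disjoint_sdiff (s := D))
    have := congrArg (fun S => S \ D) hAB
    simpa [union_sdiff_cancel_left hA', union_sdiff_cancel_left hB'] using this

/-- The laminar families are partitioned into the intervals from the descents of `M` to `M`. -/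
theorem laminarSum_univ (hP : NaturallyLabeled P) :
    laminarSum P univ = ∑ M ∈ fullFamilies P,
      q ^ (∑ J ∈ descents M, J.1.card) / ∏ J ∈ M, qBracket J.1.card := by
  classical
  have hmaps : ∀ N ∈ laminarIn P univ, canon hP N ∈ fullFamilies P := fun N _ =>
    mem_fullFamilies.2 (isFull_canon hP N)
  rw [laminarSum, ← sum_fiberwise_of_maps_to hmaps]
  refine sum_congr rfl fun M hM => ?_
  have hM := mem_fullFamilies.1 hM
  have hDM : descents M ⊆ M := filter_subset _ _
  have h1 : (laminarIn P univ).filter (fun N => canon hP N = M) = Icc (descents M) M := by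
    ext N
    rw [mem_filter, mem_laminarIn, mem_Icc]
    constructor
    · rintro ⟨⟨hN, -⟩, rfl⟩
      exact ⟨descents_canon_subset hP hN, subset_canon hP hN⟩
    · rintro ⟨h1, h2⟩
      exact ⟨⟨fun J hJ K hK => hM.laminar J (h2 hJ) K (h2 hK), fun _ _ => subset_univ _⟩,
        (eq_canon hP hM h2 h1).symm⟩
  -- Descents contribute q^|J| (1 + y) and the other members 1 + y, so the factors 1 + y recombine
  -- over all of `M`.
  rw [h1, sum_Icc_prod _ hDM, prod_congr rfl fun J _ => idealWeight_eq J, prod_mul_distrib,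
    prod_pow_eq_pow_sum, mul_assoc, mul_comm (∏ J ∈ descents M, (1 + idealWeight J)),
    prod_sdiff hDM, prod_congr rfl fun J _ => one_add_idealWeight J, prod_div_distrib,
    prod_const_one, mul_one_div]

/-! ### Connected components of the graph of connected ideals -/

theorem IsFull.mem_of_compatible {M : Finset (ConnIdeal P)} (hM : IsFull M) {J : ConnIdeal P}
    (hJ : ∀ K : ConnIdeal P, Compatible J.1 K.1) : J ∈ M := by
  classical
  by_contra hJM
  have hlam : Laminar (insert J M) := by
    intro A hA B hB
    rcases mem_insert.1 hA with rfl | hA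
    · exact hJ B
    · rcases mem_insert.1 hB with rfl | hB
      · exact (hJ A).symm
      · exact hM.laminar A hA B hB
  have := hlam.card_le
  rw [card_insert_of_notMem hJM, hM.card_eq] at this
  omega

theorem mem_supp_of_adj {C : (idealGraph P).ConnectedComponent} {J K : ConnIdeal P}
    (hJ : J ∈ C.supp) (h : (idealGraph P).Adj J K) : K ∈ C.supp :=
  (C.mem_supp_congr_adj h).1 hJ

theorem compatible_of_mem_of_notMem {C : (idealGraph P).ConnectedComponent} {J K : ConnIdeal P}
    (hJ : J ∈ C.supp) (hK : K ∉ C.supp) : Compatible J.1 K.1 :=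
  not_adj_iff.1 fun h => hK (mem_supp_of_adj hJ h)

theorem component_induction {C : (idealGraph P).ConnectedComponent} {p : ConnIdeal P → Prop}
    {J : ConnIdeal P} (hJ : J ∈ C.supp) (h0 : p J)
    (hstep : ∀ K L, K ∈ C.supp → L ∈ C.supp → (idealGraph P).Adj K L → p K → p L)
    {K : ConnIdeal P} (hK : K ∈ C.supp) : p K := by
  have hr : (idealGraph P).Reachable J K :=
    SimpleGraph.ConnectedComponent.exact (Eq.trans hJ (Eq.symm hK))
  rw [SimpleGraph.reachable_iff_reflTransGen] at hr
  have key : K ∈ C.supp ∧ p K := by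
    clear hK
    induction hr with
    | refl => exact ⟨hJ, h0⟩
    | tail _ h ih =>
      have := mem_supp_of_adj ih.1 h
      exact ⟨this, hstep _ _ ih.1 this h ih.2⟩
  exact key.2

theorem exists_mem_of_adj {J K : ConnIdeal P} (h : (idealGraph P).Adj J K) :
    ∃ x, x ∈ J.1 ∧ x ∈ K.1 := by
  obtain ⟨x, hx⟩ := h.1
  exact ⟨x, mem_inter.1 hx⟩

/-- Adjacent ideals share an element, so any splitting of the union into two ideals leaves all
members of `C` on the same side. -/
theorem exists_componentIdeal (C : (idealGraph P).ConnectedComponent) :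
    ∃ U : ConnIdeal P, ∀ x, x ∈ U.1 ↔ ∃ J ∈ C.supp, x ∈ J.1 := by
  classical
  let U : Finset (Fin n) := univ.filter fun x => ∃ J ∈ C.supp, x ∈ J.1
  have hU : ∀ x, x ∈ U ↔ ∃ J ∈ C.supp, x ∈ J.1 := fun x => by simp [U]
  refine ⟨⟨U, isConnIdeal_of_forall ?_ ?_ ?_⟩, hU⟩
  · intro i hi j hj
    obtain ⟨J, hJ, hiJ⟩ := (hU i).1 hi
    exact (hU j).2 ⟨J, hJ, J.2.isDown i hiJ j hj⟩
  · obtain ⟨J, hJ⟩ := C.nonempty_supp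
    obtain ⟨x, hx⟩ := J.2.nonempty
    exact ⟨x, (hU x).2 ⟨J, hJ, hx⟩⟩
  · rintro A B hA hB hd hAB ⟨x, hx⟩ y hy
    have hsub : ∀ J ∈ C.supp, J.1 ⊆ A ∪ B := fun J hJ z hz => by
      rw [hAB]
      exact (hU z).2 ⟨J, hJ, hz⟩
    have hxU : x ∈ U := hAB ▸ mem_union_left _ hx
    obtain ⟨J, hJ, hxJ⟩ := (hU x).1 hxU
    obtain ⟨K, hK, hyK⟩ := (hU y).1 hy
    have key : K.1 ⊆ A := by
      refine component_induction (p := fun K => K.1 ⊆ A) hJ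
        (J.2.subset_of_mem hA hB hd (hsub J hJ) hxJ hx) (fun K L _ hL hadj hKA => ?_) hK
      obtain ⟨z, hzK, hzL⟩ := exists_mem_of_adj hadj
      exact L.2.subset_of_mem hA hB hd (hsub L hL) hzL (hKA hzK)
    exact key hyK

/-- The union of the members of a connected component of the graph of connected ideals. -/
noncomputable def componentIdeal (C : (idealGraph P).ConnectedComponent) : ConnIdeal P :=
  (exists_componentIdeal C).choose

theorem mem_componentIdeal {C : (idealGraph P).ConnectedComponent} {x : Fin n} :
    x ∈ (componentIdeal C).1 ↔ ∃ J ∈ C.supp, x ∈ J.1 :=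
  (exists_componentIdeal C).choose_spec x

theorem subset_componentIdeal {C : (idealGraph P).ConnectedComponent} {J : ConnIdeal P}
    (hJ : J ∈ C.supp) : J.1 ⊆ (componentIdeal C).1 := fun _ hx =>
  mem_componentIdeal.2 ⟨J, hJ, hx⟩

/-- Lying inside `A` propagates along the edges of `C`: a neighbor of an ideal inside `A` meets `A`,
and cannot contain `A` without containing that ideal. -/
theorem componentIdeal_subset {C : (idealGraph P).ConnectedComponent} {A B : ConnIdeal P}
    (hB : B ∈ C.supp) (hA : A ∉ C.supp) (hBA : B.1 ⊆ A.1) : (componentIdeal C).1 ⊆ A.1 := by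
  intro x hx
  obtain ⟨K, hK, hxK⟩ := mem_componentIdeal.1 hx
  refine component_induction (p := fun K => K.1 ⊆ A.1) hB hBA
    (fun K L hK hL hadj hKA => ?_) hK hxK
  obtain ⟨z, hzK, hzL⟩ := exists_mem_of_adj hadj
  rcases (compatible_of_mem_of_notMem hL hA).nested hzL (hKA hzK) with h | h
  · exact h
  · exact absurd (hKA.trans h) hadj.2.1

theorem componentIdeal_compatible (C : (idealGraph P).ConnectedComponent) (A : ConnIdeal P) :
    Compatible (componentIdeal C).1 A.1 := by
  by_cases hA : A ∈ C.supp
  · exact Or.inr (Or.inr (subset_componentIdeal hA))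
  by_cases hd : Disjoint (componentIdeal C).1 A.1
  · exact Or.inl hd
  obtain ⟨x, hxU, hxA⟩ := not_disjoint_iff.1 hd
  obtain ⟨B, hB, hxB⟩ := mem_componentIdeal.1 hxU
  rcases (compatible_of_mem_of_notMem hB hA).nested hxB hxA with h | h
  · exact Or.inr (Or.inl (componentIdeal_subset hB hA h))
  · exact Or.inr (Or.inr (h.trans (subset_componentIdeal hB)))

theorem componentIdeal_mem {M : Finset (ConnIdeal P)} (hM : IsFull M)
    (C : (idealGraph P).ConnectedComponent) : componentIdeal C ∈ M :=
  hM.mem_of_compatible (componentIdeal_compatible C)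

/-- A connected ideal compatible with all others is alone in its component. -/
theorem eq_of_forall_compatible {C : (idealGraph P).ConnectedComponent} {J : ConnIdeal P}
    (hJ : J ∈ C.supp) (hcomp : ∀ K : ConnIdeal P, Compatible J.1 K.1) {K : ConnIdeal P}
    (hK : K ∈ C.supp) : K = J := by
  refine component_induction (p := fun K => K = J) hJ rfl (fun K L _ _ hadj hKJ => ?_) hK
  subst hKJ
  exact absurd hadj (not_adj_iff.2 (hcomp L))

theorem componentIdeal_eq {C : (idealGraph P).ConnectedComponent} {J : ConnIdeal P}
    (hJ : J ∈ C.supp) (hcomp : ∀ K : ConnIdeal P, Compatible J.1 K.1) :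
    componentIdeal C = J := by
  refine Subtype.ext (Subset.antisymm (fun x hx => ?_) (subset_componentIdeal hJ))
  obtain ⟨K, hK, hxK⟩ := mem_componentIdeal.1 hx
  exact eq_of_forall_compatible hJ hcomp hK ▸ hxK

/-! ### Descents depend only on one component -/

/-- A member `K` of `M` outside `C` may be absent from `M'`, but it can be replaced by the union of
its component, which lies in every full family. The hypothesis `hC` keeps that union strictly inside
`J`. -/
theorem mu_subset_of_agree {M M' : Finset (ConnIdeal P)} (hM' : IsFull M')
    {C : (idealGraph P).ConnectedComponent} (hagree : ∀ J ∈ C.supp, J ∈ M ↔ J ∈ M')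
    (hC : componentIdeal C ∉ C.supp) {J : ConnIdeal P}
    (hJ : J ∈ C.supp ∨ J = componentIdeal C) : mu M J ⊆ mu M' J := by
  intro x hx
  obtain ⟨K, hK, hKJ, hxK⟩ := mem_mu.1 hx
  by_cases hKC : K ∈ C.supp
  · exact mem_mu.2 ⟨K, (hagree K hKC).1 hK, hKJ, hxK⟩
  set D := (idealGraph P).connectedComponentMk K with hD
  have hKD : K ∈ D.supp := rfl
  have hCD : ∀ B ∈ C.supp, B ∉ D.supp := by
    intro B hBC hBD
    have : C = D := Eq.trans (Eq.symm hBC) hBD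
    exact hKC (this ▸ hKD)
  have key : (componentIdeal D).1 ⊂ J.1 := by
    rcases hJ with hJ | rfl
    · have h1 := componentIdeal_subset hKD (hCD J hJ) hKJ.1
      refine ⟨h1, fun h2 => hC ?_⟩
      have h3 : componentIdeal D = J := Subtype.ext (Subset.antisymm h1 h2)
      rw [componentIdeal_eq hJ (h3 ▸ componentIdeal_compatible D)]
      exact hJ
    · obtain ⟨y, hy⟩ := K.2.nonempty
      obtain ⟨B, hB, hyB⟩ := mem_componentIdeal.1 (hKJ.1 hy)
      rcases (compatible_of_mem_of_notMem hB hKC).nested hyB hy with h | h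
      · exact absurd (componentIdeal_subset hB hKC h) hKJ.2
      · have h1 := componentIdeal_subset hKD (hCD B hB) h
        refine ⟨h1.trans (subset_componentIdeal hB), fun h2 => hC ?_⟩
        have h3 : componentIdeal C = B :=
          Subtype.ext (Subset.antisymm (h2.trans h1) (subset_componentIdeal hB))
        rw [h3]
        exact hB
  exact mem_mu.2 ⟨componentIdeal D, componentIdeal_mem hM' D, key, subset_componentIdeal hKD hxK⟩

theorem mu_eq_of_agree {M M' : Finset (ConnIdeal P)} (hM : IsFull M) (hM' : IsFull M')
    {C : (idealGraph P).ConnectedComponent} (hagree : ∀ J ∈ C.supp, J ∈ M ↔ J ∈ M')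
    (hC : componentIdeal C ∉ C.supp) {J : ConnIdeal P}
    (hJ : J ∈ C.supp ∨ J = componentIdeal C) : mu M J = mu M' J :=
  Subset.antisymm (mu_subset_of_agree hM' hagree hC hJ)
    (mu_subset_of_agree hM (fun J hJ => (hagree J hJ).symm) hC hJ)

/-- Let `i` be the label of `J` and `j` that of its parent. The principal ideal of `j` meets `J`, so
by compatibility it contains `J`; hence `i` is below `j` in `P`, and natural labeling excludes a
descent. -/
theorem not_isDescent_of_forall_compatible (hP : NaturallyLabeled P)
    {M : Finset (ConnIdeal P)} (hM : IsFull M) {J : ConnIdeal P}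
    (hcomp : ∀ K : ConnIdeal P, Compatible J.1 K.1) : ¬ IsDescent M J := by
  rintro ⟨K, hK, hJK, hcov, i, j, hi, hj, hij⟩
  have hiJ := (mem_and_notMem_of_sdiff hi).1
  have hjK := (mem_and_notMem_of_sdiff hj).1
  obtain ⟨D, hD, hDj⟩ := isConnIdeal_principal (P := P) j
  have hjJ : j ∉ J.1 := by
    intro h
    have hJM := hM.mem_of_compatible hcomp
    exact hJK.2 (hM.laminar.subset_of_sdiff_mu_eq hK hJM hj h)
  -- Otherwise `J` would split off from its connected parent `K`: an element of `K` above one of `J`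
  -- but outside `J` would differ from `j`, so lie in a member strictly between `J` and `K`.
  have hmeet : ∃ x ∈ J.1, P.le x j := by
    by_contra hcon
    push Not at hcon
    have hdown : IsDown P (K.1 \ J.1) := by
      intro y hy z hz
      obtain ⟨hyK, hyJ⟩ := mem_sdiff.1 hy
      refine mem_sdiff.2 ⟨K.2.isDown y hyK z hz, fun hzJ => ?_⟩
      have hyj : y ≠ j := fun h => hcon z hzJ (h ▸ hz)
      have hymu : y ∈ mu M K := by
        by_contra h
        have : y ∈ K.1 \ mu M K := mem_sdiff.2 ⟨hyK, h⟩
        rw [hj, mem_singleton] at this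
        exact hyj this
      obtain ⟨L, hL, hLK, hyL⟩ := mem_mu.1 hymu
      rcases (hcomp L).nested hzJ (L.2.isDown y hyL z hz) with h | h
      · exact hcov L hL ⟨h, fun h' => hyJ (h' hyL)⟩ hLK
      · exact hyJ (h hyL)
    exact hJK.2 (subset_component J.2.isDown hdown K.2 Subset.rfl (hJK.1 hiJ) hiJ)
  obtain ⟨x, hxJ, hxj⟩ := hmeet
  rcases (hcomp ⟨D, hD⟩).nested hxJ ((hDj x).2 hxj) with h | h
  · have h1 : P.le i j := (hDj i).1 (h hiJ)
    have h2 : i ≠ j := fun h => hjJ (h ▸ hiJ)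
    have h3 := hP i j (@lt_of_le_of_ne _ P _ _ h1 h2)
    exact absurd h3 (Nat.lt_asymm hij)
  · exact hjJ (h ((hDj j).2 (P.le_refl j)))

/-- If the union of `C` is in `C`, then `J` is alone there and is never a descent. Otherwise the
parent of `J` is in `C` or is that union, and both the parent and the two labels are the same for
`M` and `M'`. -/
theorem isDescent_of_agree (hP : NaturallyLabeled P) {M M' : Finset (ConnIdeal P)}
    (hM : IsFull M) (hM' : IsFull M') {C : (idealGraph P).ConnectedComponent}
    (hagree : ∀ J ∈ C.supp, J ∈ M ↔ J ∈ M') {J : ConnIdeal P} (hJ : J ∈ C.supp)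
    (h : IsDescent M J) : IsDescent M' J := by
  by_cases hC : componentIdeal C ∈ C.supp
  · refine absurd h (not_isDescent_of_forall_compatible hP hM ?_)
    rw [eq_of_forall_compatible hC (componentIdeal_compatible C) hJ]
    exact componentIdeal_compatible C
  obtain ⟨K, hK, hJK, hcov, i, j, hi, hj, hij⟩ := h
  have hJU : J.1 ⊂ (componentIdeal C).1 := by
    refine ⟨subset_componentIdeal hJ, fun h => hC ?_⟩
    have : J = componentIdeal C := Subtype.ext (Subset.antisymm (subset_componentIdeal hJ) h)
    exact this ▸ hJ
  have hKC : K ∈ C.supp ∨ K = componentIdeal C := by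
    by_cases hKC : K ∈ C.supp
    · exact Or.inl hKC
    · right
      have h1 := componentIdeal_subset hJ hKC hJK.1
      by_contra hne
      exact hcov _ (componentIdeal_mem hM C) hJU
        ⟨h1, fun h2 => hne (Subtype.ext (Subset.antisymm h2 h1))⟩
  have hKM' : K ∈ M' := by
    rcases hKC with h | rfl
    · exact (hagree K h).1 hK
    · exact componentIdeal_mem hM' C
  refine ⟨K, hKM', hJK, fun L hL hJL hLK => ?_, i, j, ?_, ?_, hij⟩
  · by_cases hLC : L ∈ C.supp
    · exact hcov L ((hagree L hLC).2 hL) hJL hLK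
    · have h1 := componentIdeal_subset hJ hLC hJL.1
      rcases hKC with h | rfl
      · exact hLK.2 ((subset_componentIdeal h).trans h1)
      · exact hLK.2 h1
  · rw [← mu_eq_of_agree hM hM' hagree hC (Or.inl hJ), hi]
  · rw [← mu_eq_of_agree hM hM' hagree hC hKC, hj]

/-- `desBarIn Mr M` consists of the members of `Mr` that are descents of `M`. -/
theorem mem_desBarIn (M : MaxIndep P) (hM : IsFull M.1) {Mr : Finset (ConnIdeal P)}
    (hMr : Mr ⊆ M.1) {J : ConnIdeal P} :
    J ∈ desBarIn Mr M ↔ J ∈ Mr ∧ IsDescent M.1 J := by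
  have huniq : ∀ {A B : ConnIdeal P} {i : Fin n}, A ∈ M.1 → B ∈ M.1 →
      A.1 \ mu M.1 A = {i} → B.1 \ mu M.1 B = {i} → A = B := by
    intro A B i hA hB h1 h2
    exact hM.laminar.eq_of_mem hA hB (x := i) (by rw [h1]; exact mem_singleton_self i)
      (by rw [h2]; exact mem_singleton_self i)
  have hmem : J ∈ desBarIn Mr M ↔ J ∈ Mr ∧ ∃ i ∈ desIn Mr M, J.1 \ mu M.1 J = {i} := by
    simp [desBarIn]
  rw [hmem]
  refine and_congr_right fun hJ => ?_
  constructor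
  · rintro ⟨i, ⟨⟨j, ⟨⟨Ja, ha, K, hK, h1, h2, h3⟩, hcov⟩, hji⟩, -⟩, hi⟩
    obtain rfl := huniq (hMr hJ) ha hi h1
    refine ⟨K, hK, h3, fun L hL hJL hLK => ?_, i, j, hi, h2, hji⟩
    obtain ⟨l, hl⟩ := hM.exists_sdiff_mu_eq hL
    exact hcov (c := l) ⟨J, ha, L, hL, h1, hl, hJL⟩ ⟨L, hL, K, hK, hl, h2, hLK⟩
  · rintro ⟨K, hK, hJK, hcov, i, j, hi, hj, hji⟩
    refine ⟨i, ⟨⟨j, ⟨⟨J, hMr hJ, K, hK, hi, hj, hJK⟩, ?_⟩, hji⟩, J, hJ, hi⟩, hi⟩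
    rintro c ⟨A, hA, B, hB, h1, h2, h3⟩ ⟨B', hB', D, hD, h4, h5, h6⟩
    obtain rfl := huniq (hMr hJ) hA hi h1
    obtain rfl := huniq hB hB' h2 h4
    obtain rfl := huniq hK hD hj h5
    exact hcov B hB h3 h6

/-! ### Factorization over the components -/

theorem mem_compMaxIndep {C : (idealGraph P).ConnectedComponent} {S : Finset (ConnIdeal P)} :
    S ∈ compMaxIndep C ↔ (∀ J ∈ S, J ∈ C.supp) ∧ Laminar S ∧
      ∀ T : Finset (ConnIdeal P), (∀ J ∈ T, J ∈ C.supp) → Laminar T → T.card ≤ S.card := by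
  classical
  have hind : ∀ S : Finset C, C.toSimpleGraph.IsIndepSet (S : Set C) ↔
      Laminar (S.map (Function.Embedding.subtype _)) := by
    intro S
    constructor
    · intro h J hJ K hK
      obtain ⟨J, hJS, rfl⟩ := mem_map.1 hJ
      obtain ⟨K, hKS, rfl⟩ := mem_map.1 hK
      by_cases hne : J = K
      · exact Or.inr (Or.inl (hne ▸ Subset.rfl))
      · exact not_adj_iff.1 (h hJS hKS hne)
    · intro h J hJ K hK _
      exact not_adj_iff.2 (h _ (mem_map_of_mem _ hJ) _ (mem_map_of_mem _ hK))
  have hmap : ∀ T : Finset (ConnIdeal P), (∀ J ∈ T, J ∈ C.supp) →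
      ∃ S : Finset C, S.map (Function.Embedding.subtype _) = T := fun T hT =>
    ⟨T.subtype (· ∈ C), subtype_map_of_mem hT⟩
  have hmem : S ∈ compMaxIndep C ↔ ∃ S' : Finset C, C.toSimpleGraph.IsMaximumIndepSet S' ∧
      S'.map (Function.Embedding.subtype _) = S := by
    simp [compMaxIndep]
  rw [hmem]
  constructor
  · rintro ⟨S, hS, rfl⟩
    refine ⟨fun J hJ => ?_, (hind S).1 hS.isIndepSet, fun T hT hlam => ?_⟩
    · obtain ⟨J, -, rfl⟩ := mem_map.1 hJ
      exact J.2
    · obtain ⟨T, rfl⟩ := hmap T hT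
      rw [card_map, card_map]
      exact hS.maximum T ((hind T).2 hlam)
  · rintro ⟨h1, h2, h3⟩
    obtain ⟨S, rfl⟩ := hmap S h1
    refine ⟨S, ⟨(hind S).2 h2, fun T hT => ?_⟩, rfl⟩
    have := h3 (T.map (Function.Embedding.subtype _)) (fun J hJ => by
      obtain ⟨J, -, rfl⟩ := mem_map.1 hJ
      exact J.2) ((hind T).1 hT)
    rwa [card_map, card_map] at this

open Classical in
/-- The members of `M` in the component `C`. -/
noncomputable def part (C : (idealGraph P).ConnectedComponent) (M : Finset (ConnIdeal P)) :
    Finset (ConnIdeal P) :=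
  M.filter fun J => (idealGraph P).connectedComponentMk J = C

theorem mem_part {C : (idealGraph P).ConnectedComponent} {M : Finset (ConnIdeal P)}
    {J : ConnIdeal P} : J ∈ part C M ↔ J ∈ M ∧ J ∈ C.supp := by
  simp [part]

theorem coe_inter_supp_eq_iff {C : (idealGraph P).ConnectedComponent}
    {M S : Finset (ConnIdeal P)} :
    (M : Set (ConnIdeal P)) ∩ C.supp = (S : Set (ConnIdeal P)) ↔ part C M = S := by
  rw [← coe_inj]
  have : (part C M : Set (ConnIdeal P)) = (M : Set (ConnIdeal P)) ∩ C.supp := by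
    ext J
    exact mem_part
  rw [this]

theorem part_subset (C : (idealGraph P).ConnectedComponent) (M : Finset (ConnIdeal P)) :
    part C M ⊆ M := fun _ hJ => (mem_part.1 hJ).1

theorem sum_part {K : Type*} [AddCommMonoid K] (M : Finset (ConnIdeal P)) (g : ConnIdeal P → K) :
    ∑ C, ∑ J ∈ part C M, g J = ∑ J ∈ M, g J := by
  classical
  exact sum_fiberwise M _ g

theorem prod_part {K : Type*} [CommMonoid K] (M : Finset (ConnIdeal P)) (g : ConnIdeal P → K) :
    ∏ C, ∏ J ∈ part C M, g J = ∏ J ∈ M, g J := by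
  classical
  exact prod_fiberwise M _ g

theorem card_eq_sum_part (M : Finset (ConnIdeal P)) : M.card = ∑ C, (part C M).card := by
  simp only [card_eq_sum_ones]
  exact (sum_part M _).symm

theorem Laminar.mono {M N : Finset (ConnIdeal P)} (hM : Laminar M) (h : N ⊆ M) : Laminar N :=
  fun J hJ K hK => hM J (h hJ) K (h hK)

/-- Exchange: replacing the part of `M` in `C` by another laminar family of `C` keeps the family
laminar, so its size stays at most n. -/
theorem part_mem_compMaxIndep {M : Finset (ConnIdeal P)} (hM : IsFull M)
    (C : (idealGraph P).ConnectedComponent) : part C M ∈ compMaxIndep C := by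
  classical
  refine mem_compMaxIndep.2 ⟨fun J hJ => (mem_part.1 hJ).2,
    hM.laminar.mono (part_subset _ _), fun T hT hlam => ?_⟩
  have hlam' : Laminar ((M \ part C M) ∪ T) := by
    have hcross : ∀ J ∈ M \ part C M, ∀ K ∈ T, Compatible J.1 K.1 := by
      intro J hJ K hK
      obtain ⟨h1, h2⟩ := mem_sdiff.1 hJ
      exact (compatible_of_mem_of_notMem (hT K hK) fun h => h2 (mem_part.2 ⟨h1, h⟩)).symm
    intro J hJ K hK
    rcases mem_union.1 hJ with hJ | hJ
    · rcases mem_union.1 hK with hK | hK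
      · exact hM.laminar J (sdiff_subset hJ) K (sdiff_subset hK)
      · exact hcross J hJ K hK
    · rcases mem_union.1 hK with hK | hK
      · exact (hcross K hK J hJ).symm
      · exact hlam J hJ K hK
  have hdisj : Disjoint (M \ part C M) T := by
    refine disjoint_left.2 fun J hJ hJT => ?_
    obtain ⟨h1, h2⟩ := mem_sdiff.1 hJ
    exact h2 (mem_part.2 ⟨h1, hT J hJT⟩)
  have h1 := hlam'.card_le
  have h2 := card_sdiff_add_card_eq_card (part_subset C M)
  have h3 := hM.card_eq
  rw [card_union_of_disjoint hdisj] at h1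
  omega

open Classical in
/-- The union of a choice of families, one for each component. -/
noncomputable def glue (f : (idealGraph P).ConnectedComponent → Finset (ConnIdeal P)) :
    Finset (ConnIdeal P) :=
  univ.biUnion f

theorem mem_glue {f : (idealGraph P).ConnectedComponent → Finset (ConnIdeal P)}
    {J : ConnIdeal P} : J ∈ glue f ↔ ∃ C, J ∈ f C := by
  simp [glue]

theorem part_glue {f : (idealGraph P).ConnectedComponent → Finset (ConnIdeal P)}
    (hf : ∀ C, f C ∈ compMaxIndep C) (C : (idealGraph P).ConnectedComponent) :
    part C (glue f) = f C := by
  ext J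
  rw [mem_part, mem_glue]
  constructor
  · rintro ⟨⟨D, hD⟩, hC⟩
    have hJD := (mem_compMaxIndep.1 (hf D)).1 J hD
    have : D = C := Eq.trans (Eq.symm hJD) hC
    exact this ▸ hD
  · intro hJ
    exact ⟨⟨C, hJ⟩, (mem_compMaxIndep.1 (hf C)).1 J hJ⟩

/-- Laminarity across components is automatic, and the size of a competing family can be compared
component by component. -/
theorem isFull_glue (hP : NaturallyLabeled P)
    {f : (idealGraph P).ConnectedComponent → Finset (ConnIdeal P)}
    (hf : ∀ C, f C ∈ compMaxIndep C) : IsFull (glue f) := by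
  have hlam : Laminar (glue f) := by
    intro J hJ K hK
    obtain ⟨C, hC⟩ := mem_glue.1 hJ
    obtain ⟨D, hD⟩ := mem_glue.1 hK
    have hC' := mem_compMaxIndep.1 (hf C)
    by_cases hKC : K ∈ C.supp
    · have hK' : K ∈ f C := by
        rw [← part_glue hf C]
        exact mem_part.2 ⟨hK, hKC⟩
      exact hC'.2.1 J hC K hK'
    · exact compatible_of_mem_of_notMem (hC'.1 J hC) hKC
  rw [isFull_iff hP]
  refine ⟨laminar_iff_isIndepSet.1 hlam, fun T hT => ?_⟩
  rw [card_eq_sum_part T, card_eq_sum_part (glue f)]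
  refine sum_le_sum fun C _ => ?_
  rw [part_glue hf C]
  exact (mem_compMaxIndep.1 (hf C)).2.2 _ (fun J hJ => (mem_part.1 hJ).2)
    ((laminar_iff_isIndepSet.2 hT).mono (part_subset _ _))

theorem exists_isFull_part_eq (hP : NaturallyLabeled P) {C : (idealGraph P).ConnectedComponent}
    {Mr : Finset (ConnIdeal P)} (hMr : Mr ∈ compMaxIndep C) :
    ∃ M : Finset (ConnIdeal P), IsFull M ∧ part C M = Mr := by
  classical
  -- Outside `C` any maximum choice would do; the parts of the completion of the empty family serve.
  have hf : ∀ D, Function.update (fun D => part D (canon hP ∅)) C Mr D ∈ compMaxIndep D := by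
    intro D
    by_cases h : D = C
    · subst h
      rwa [Function.update_self]
    · rw [Function.update_of_ne h]
      exact part_mem_compMaxIndep (isFull_canon hP ∅) D
  exact ⟨_, isFull_glue hP hf, by rw [part_glue hf, Function.update_self]⟩

theorem desBarIn_eq (hP : NaturallyLabeled P) {C : (idealGraph P).ConnectedComponent}
    {Mr : Finset (ConnIdeal P)} {M : MaxIndep P} (hpart : part C M.1 = Mr) :
    desBarIn Mr M = part C (descents M.1) := by
  subst hpart
  ext J
  rw [mem_desBarIn M ((isFull_iff hP).2 M.2) (part_subset _ _), mem_part, mem_part, mem_descents]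
  tauto

theorem desBar_part (hP : NaturallyLabeled P) {M : Finset (ConnIdeal P)} (hM : IsFull M)
    (C : (idealGraph P).ConnectedComponent) :
    desBar C (part C M) = part C (descents M) := by
  have hex : ∃ M' : MaxIndep P,
      (M'.1 : Set (ConnIdeal P)) ∩ C.supp = (part C M : Set (ConnIdeal P)) :=
    ⟨⟨M, (isFull_iff hP).1 hM⟩, coe_inter_supp_eq_iff.2 rfl⟩
  rw [desBar, dif_pos hex]
  have hspec := coe_inter_supp_eq_iff.1 hex.choose_spec
  rw [desBarIn_eq hP hspec]
  have hM' := (isFull_iff hP).2 hex.choose.2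
  have hagree : ∀ J ∈ C.supp, J ∈ hex.choose.1 ↔ J ∈ M := by
    intro J hJ
    have := congrArg (J ∈ ·) hspec
    simpa [mem_part, hJ] using this
  ext J
  rw [mem_part, mem_part, mem_descents, mem_descents]
  refine and_congr_left fun hJ => and_congr (hagree J hJ) ⟨fun h => ?_, fun h => ?_⟩
  · exact isDescent_of_agree hP hM' hM hagree hJ h
  · exact isDescent_of_agree hP hM hM' (fun J hJ => (hagree J hJ).symm) hJ h

/-- Expanding the product chooses one maximum family in each component; `glue` and `part` identify
such choices with full families. -/
theorem prod_sum_compMaxIndep (hP : NaturallyLabeled P) {K : Type*} [CommSemiring K]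
    (g : (idealGraph P).ConnectedComponent → Finset (ConnIdeal P) → K) :
    ∏ C, ∑ Mr ∈ compMaxIndep C, g C Mr = ∑ M ∈ fullFamilies P, ∏ C, g C (part C M) := by
  classical
  rw [prod_univ_sum]
  refine sum_bij' (fun f _ => glue f) (fun M _ C => part C M) ?_ ?_ ?_ ?_ ?_
  · intro f hf
    exact mem_fullFamilies.2 (isFull_glue hP (Fintype.mem_piFinset.1 hf))
  · intro M hM
    exact Fintype.mem_piFinset.2 (part_mem_compMaxIndep (mem_fullFamilies.1 hM))
  · intro f hf
    exact funext (part_glue (Fintype.mem_piFinset.1 hf))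
  · intro M _
    ext J
    simp [mem_glue, mem_part]
  · intro f hf
    exact prod_congr rfl fun C _ => by rw [part_glue (Fintype.mem_piFinset.1 hf)]

end ConnectedOrderIdeals

theorem mainTheorem5 (n : ℕ) (P : PartialOrder (Fin n))
    (hP : ConnectedOrderIdeals.NaturallyLabeled P) :
    (∀ C : (ConnectedOrderIdeals.idealGraph P).ConnectedComponent,
      ∀ Mr ∈ ConnectedOrderIdeals.compMaxIndep C,
        (∃ M : ConnectedOrderIdeals.MaxIndep P,
          (M.1 : Set (ConnectedOrderIdeals.ConnIdeal P)) ∩ C.supp =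
            (Mr : Set (ConnectedOrderIdeals.ConnIdeal P))) ∧
        ∀ M : ConnectedOrderIdeals.MaxIndep P,
          (M.1 : Set (ConnectedOrderIdeals.ConnIdeal P)) ∩ C.supp =
            (Mr : Set (ConnectedOrderIdeals.ConnIdeal P)) →
          ConnectedOrderIdeals.desBarIn Mr M = ConnectedOrderIdeals.desBar C Mr) ∧
    ∑ w ∈ ConnectedOrderIdeals.linearExtensions P,
        ConnectedOrderIdeals.q ^ ConnectedOrderIdeals.maj w =
      ConnectedOrderIdeals.qFactorial n *
        ∏ C : (ConnectedOrderIdeals.idealGraph P).ConnectedComponent,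
          ∑ Mr ∈ ConnectedOrderIdeals.compMaxIndep C,
            ConnectedOrderIdeals.q ^ (∑ J ∈ ConnectedOrderIdeals.desBar C Mr, J.1.card) /
              ∏ J ∈ Mr, ConnectedOrderIdeals.qBracket J.1.card := by
  open ConnectedOrderIdeals in
  refine ⟨fun C Mr hMr => ⟨?_, fun M hM => ?_⟩, ?_⟩
  · obtain ⟨M, hM, hpart⟩ := exists_isFull_part_eq hP hMr
    exact ⟨⟨M, (isFull_iff hP).1 hM⟩, coe_inter_supp_eq_iff.2 hpart⟩
  · have hpart := coe_inter_supp_eq_iff.1 hM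
    rw [desBarIn_eq hP hpart, ← hpart, desBar_part hP ((isFull_iff hP).2 M.2)]
  · rw [sum_linearExtensions hP, laminarSum_univ hP, prod_sum_compMaxIndep hP]
    congr 1
    refine Finset.sum_congr rfl fun M hM => ?_
    have hM := mem_fullFamilies.1 hM
    simp only [desBar_part hP hM]
    rw [Finset.prod_div_distrib, prod_part, Finset.prod_pow_eq_pow_sum, sum_part]
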